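/- A plane tree is a rooted tree in which the children of every vertex are linearly ordered; a leaf is a vertex without children. The protection number of a plane tree is the minimal distance of its root to a leaf. For $n\ge 1$ let $X_n$ be the protection number of a plane tree chosen uniformly at random among all plane trees with $n$ vertices. For integers $k\ge 0$ set $$a_k=\frac{27\cdot 4^k(4^{2k}-1)}{(4^k+2)^2(2\cdot 4^k+1)^2},$$ $$b_k=\frac{81\cdot 4^k\bigl(4(k-3)4^{6k}+36\cdot 4^{5k}-(45k-72)4^{4k}-80k\,4^{3k}-(45k+72)4^{2k}-36\cdot 4^k+4(k+3)\bigr)}{2(4^k+2)^4(2\cdot 4^k+1)^4}.$$ Then, as $n\to\infty$, $X_n$ tends to a discrete limit distribution: $a_k\ge 0$ for all $k$, $\sum_{k\ge 0}a_k=1$, $\lim_{n\to\infty}\mathbb{P}(X_n=k)=a_k$ for every $k$, and $$\mathbb{P}(X_n=k)=a_k+\frac{b_k}{n}+O\Bigl(\frac{k^2}{3^k n^{3/2}}\Bigr)\qquad(n\to\infty)$$ uniformly in $k\ge 0$, i.e. there are $C$ and $N$ such that for all $n\ge N$ and all $k\ge 0$ the error is at most $C k^2 3^{-k} n^{-3/2}$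 in absolute value. Moreover, with the (convergent) series $$c_0=\sum_{k\ge 1}\frac{9\cdot 4^k}{(4^k+2)^2}=1.622971384715353049514658203184345989635513668984063539407825\ldots,$$ $$c_1=\sum_{k\ge 1}\frac{9\cdot 4^k\bigl((3k-8)4^{2k}+28\cdot 4^k-(12k+20)\bigr)}{2(4^k+2)^4}=0.1311873689494231825244485810366733833577429413531428274982796\ldots,$$ $$c_2=\sum_{k\ge 1}\frac{9(2k-1)4^k}{(4^k+2)^2}-c_0^2=0.71569507178333266731548919868273628601066118785422617431075\ldots,$$ $$c_3=\sum_{k\ge 1}\frac{9(2k-1)4^k\bigl((3k-8)4^{2k}+28\cdot 4^k-(12k+20)\bigr)}{2(4^k+2)^4}-2c_0c_1=0.752064239409591264131776195623037076243863867774117959593385\ldots$$ (decimals correct to within one unit of the last digit shown), expectation and variance satisfy, as $n\to\infty$, $$\mathbb{E}(X_n)=c_0+\frac{c_1}{n}+O\bigl(n^{-3/2}\bigr),\qquad \mathbb{V}(X_n)=c_2+\frac{c_3}{n}+O\bigl(n^{-3/2}\bigr).$$ -/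

import Mathlib

open Filter Topology Asymptotics MeasureTheory ProbabilityTheory

/-- Rooted plane (ordered) trees: a root together with the finite sequence, possibly empty, of the
subtrees rooted at its children. -/
inductive PlaneTree : Type
  | node (branches : List PlaneTree) : PlaneTree

namespace PlaneTree

/-- The number of vertices of a plane tree. -/
def numVertices : PlaneTree → ℕ
  | node ts => 1 + (ts.map fun t => numVertices t).sum

/-- `IsLeafDistance t d`: some leaf (childless vertex) of `t` is at distance `d` from the root. -/
inductive IsLeafDistance : PlaneTree → ℕ → Prop
  | leaf : IsLeafDistance (node []) 0
  | branch {ts : List PlaneTree} {t : PlaneTree} {d : ℕ} :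
      t ∈ ts → IsLeafDistance t d → IsLeafDistance (node ts) (d + 1)

/-- The protection number of (the root of) a plane tree: the minimal distance of the root to
a leaf. -/
noncomputable def protectionNumber (t : PlaneTree) : ℕ :=
  sInf {d : ℕ | IsLeafDistance t d}

/-- The set of plane trees with `n` vertices. -/
def ofSize (n : ℕ) : Set PlaneTree := {t | t.numVertices = n}

/-- Every set of plane trees is an event. -/
instance : MeasurableSpace PlaneTree := ⊤

/-- The law of a uniformly random plane tree with `n` vertices. -/
noncomputable def uniformLaw (n : ℕ) : Measure PlaneTree := uniformOn (ofSize n)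

/-- There are only finitely many plane trees with `n` vertices, so that `uniformLaw` is the
uniform distribution on them. -/
theorem finite_ofSize (n : ℕ) : (ofSize n).Finite := by
  have pos : ∀ t : PlaneTree, 1 ≤ t.numVertices := by
    rintro ⟨ts⟩
    rw [numVertices]
    omega
  suffices h : {t : PlaneTree | t.numVertices ≤ n}.Finite from
    h.subset fun t ht => le_of_eq ht
  induction n with
  | zero =>
    refine Set.finite_empty.subset fun t ht => ?_
    have h1 := pos t
    have h2 : t.numVertices ≤ 0 := ht
    omega
  | succ n ih =>
    have : Finite {t : PlaneTree // t.numVertices ≤ n} := ih.to_subtype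
    refine ((List.finite_length_le {t : PlaneTree // t.numVertices ≤ n} n).image
      (fun l => node (l.map Subtype.val))).subset ?_
    rintro ⟨ts⟩ ht
    have ht' : (ts.map fun t => numVertices t).sum ≤ n := by
      have h : (node ts).numVertices ≤ n + 1 := ht
      rw [numVertices] at h
      omega
    have hmem : ∀ t ∈ ts, t.numVertices ≤ n := fun t h =>
      (List.le_sum_of_mem (List.mem_map_of_mem h)).trans ht'
    refine ⟨ts.pmap Subtype.mk hmem, ?_, ?_⟩
    · have h := List.length_le_sum_of_one_le (ts.map fun t => numVertices t) (by
        intro i hi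
        obtain ⟨t, -, rfl⟩ := List.mem_map.1 hi
        exact pos t)
      simp only [List.length_map] at h
      simpa using h.trans ht'
    · simp [List.map_pmap]

end PlaneTree

namespace ProtectionNumber

/-- The probability `P(X_n = k)`, where `X_n` is the protection number of a uniformly random plane
tree with `n` vertices. -/
noncomputable def prob (n k : ℕ) : ℝ :=
  (PlaneTree.uniformLaw n).real {t | t.protectionNumber = k}

/-- The expectation `E(X_n)`. -/
noncomputable def expectation (n : ℕ) : ℝ :=
  ∫ t, (t.protectionNumber : ℝ) ∂(PlaneTree.uniformLaw n)

/-- The variance `V(X_n)`. -/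
noncomputable def var (n : ℕ) : ℝ :=
  variance (fun t : PlaneTree => (t.protectionNumber : ℝ)) (PlaneTree.uniformLaw n)

/-- The limit probabilities. -/
noncomputable def limitProb (k : ℕ) : ℝ :=
  27 * 4 ^ k * (4 ^ (2 * k) - 1) / ((4 ^ k + 2) ^ 2 * (2 * 4 ^ k + 1) ^ 2)

/-- The coefficient of `1 / n` in the expansion of `P(X_n = k)`. -/
noncomputable def corrProb (k : ℕ) : ℝ :=
  81 * 4 ^ k *
      (4 * ((k : ℝ) - 3) * 4 ^ (6 * k) + 36 * 4 ^ (5 * k) - (45 * (k : ℝ) - 72) * 4 ^ (4 * k)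
        - 80 * (k : ℝ) * 4 ^ (3 * k) - (45 * (k : ℝ) + 72) * 4 ^ (2 * k) - 36 * 4 ^ k
        + 4 * ((k : ℝ) + 3)) /
    (2 * (4 ^ k + 2) ^ 4 * (2 * 4 ^ k + 1) ^ 4)

/-- The summand of the series for `c₀`. -/
noncomputable def term0 (k : ℕ) : ℝ :=
  9 * 4 ^ k / (4 ^ k + 2) ^ 2

/-- The summand of the series for `c₁`. -/
noncomputable def term1 (k : ℕ) : ℝ :=
  9 * 4 ^ k * ((3 * (k : ℝ) - 8) * 4 ^ (2 * k) + 28 * 4 ^ k - (12 * (k : ℝ) + 20)) /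
    (2 * (4 ^ k + 2) ^ 4)

/-- The summand of the series in `c₂`. -/
noncomputable def term2 (k : ℕ) : ℝ :=
  9 * (2 * (k : ℝ) - 1) * 4 ^ k / (4 ^ k + 2) ^ 2

/-- The summand of the series in `c₃`. -/
noncomputable def term3 (k : ℕ) : ℝ :=
  9 * (2 * (k : ℝ) - 1) * 4 ^ k *
      ((3 * (k : ℝ) - 8) * 4 ^ (2 * k) + 28 * 4 ^ k - (12 * (k : ℝ) + 20)) /
    (2 * (4 ^ k + 2) ^ 4)

/-! All series below run over `k ≥ 1`. -/

noncomputable def c0 : ℝ := ∑' k : ℕ, term0 (k + 1)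

noncomputable def c1 : ℝ := ∑' k : ℕ, term1 (k + 1)

noncomputable def c2 : ℝ := (∑' k : ℕ, term2 (k + 1)) - c0 ^ 2

noncomputable def c3 : ℝ := (∑' k : ℕ, term3 (k + 1)) - 2 * c0 * c1

end ProtectionNumber

open ProtectionNumber

/-! Every tree other than a single vertex is uniquely a tree grafted as leftmost branch onto
another, and sizes add. With `T = tailGenFun 0` and `G_k = tailGenFun k` this gives `T = X + T ^ 2`
and `G_{k+1} = G_k (G_{k+1} + X)`. The second relation is a Möbius recursion and has an explicit
solution. Multiplying by the conjugate, in which `1 - T` replaces `T`, yields `G_{m+2} = X^m F_m T +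
X^m R_m` with `F_m` and `R_m` rational (`tailGenFun_eq`).

The coefficients of `T` grow like `4 ^ n` up to a power of `n`. In the weighted `ℓ¹` norm at radius
`1 / 3`, the series `X^m F_m` and `X^m R_m` have norm `O(3 ^ (-m))` uniformly in `m`. The regular
part is therefore exponentially negligible.

Singularity analysis is replaced by an elementary estimate: `4 ^ j t_{n-j} / t_n = 1 + 3j / (2n) +
O((1 + j) ^ 6 / n ^ 2)`, where `t_n` counts trees. Summed against the coefficients of `S = X^m F_m`,
it gives `P(X_n ≥ k)` as `S(1/4)` plus `3/2` times the Euler derivative of `S` at `1 / 4`, divided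
by `n`. These two numbers are `term0 k` and `term1 k`. The error is `O(3 ^ (-k) n ^ (-2))`, sharper
than the required power `n ^ (-3/2)` (`exists_abs_tailProb_sub_le`).

Differences of consecutive tails give the point probabilities. Summation by parts gives the first
two moments, since the error is summable in `k`. The decimals come from exact integer arithmetic on
240 terms and a geometric tail bound. -/

namespace PlaneTree

/-! ### Grafting decomposition and functional equations -/

open PowerSeries

/-- The tree with a single vertex. -/
def single : PlaneTree := node []

/-- Attach `t` as a new leftmost branch to the root of `u`. -/
def graft (t : PlaneTree) : PlaneTree → PlaneTree
  | node us => node (t :: us)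

theorem single_or_graft : ∀ t : PlaneTree, t = single ∨ ∃ u v, t = graft u v
  | node [] => Or.inl rfl
  | node (u :: us) => Or.inr ⟨u, node us, rfl⟩

theorem graft_ne_single (t u : PlaneTree) : graft t u ≠ single := by
  cases u
  simp [graft, single]

theorem graft_injective {t u t' u' : PlaneTree} (h : graft t u = graft t' u') :
    t = t' ∧ u = u' := by
  cases u
  cases u'
  simpa [graft] using h

theorem numVertices_single : single.numVertices = 1 := by
  simp [single, numVertices]

theorem numVertices_graft (t u : PlaneTree) :
    (graft t u).numVertices = t.numVertices + u.numVertices := by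
  cases u
  simp only [graft, numVertices, List.map_cons, List.sum_cons]
  omega

theorem numVertices_pos (t : PlaneTree) : 0 < t.numVertices := by
  cases t
  rw [numVertices]
  omega

theorem exists_isLeafDistance : ∀ t : PlaneTree, ∃ d, IsLeafDistance t d
  | node [] => ⟨0, .leaf⟩
  | node (t :: _) =>
    let ⟨d, hd⟩ := exists_isLeafDistance t
    ⟨d + 1, .branch List.mem_cons_self hd⟩

theorem le_protectionNumber_iff {t : PlaneTree} {k : ℕ} :
    k ≤ t.protectionNumber ↔ ∀ d, IsLeafDistance t d → k ≤ d := by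
  constructor
  · intro h d hd
    exact h.trans (Nat.sInf_le hd)
  · intro h
    exact h _ (Nat.sInf_mem (exists_isLeafDistance t))

theorem protectionNumber_single : single.protectionNumber = 0 :=
  Nat.le_zero.1 (Nat.sInf_le IsLeafDistance.leaf)

/-- A leaf of `t` moves one step further from the root, and a leaf of `u` keeps its distance. The
exception is `u = single`, whose root is a leaf of `u` but not of the graft. -/
theorem succ_le_protectionNumber_graft {t u : PlaneTree} {k : ℕ} :
    k + 1 ≤ (graft t u).protectionNumber ↔
      k ≤ t.protectionNumber ∧ (k + 1 ≤ u.protectionNumber ∨ u = single) := by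
  obtain ⟨us⟩ := u
  simp only [le_protectionNumber_iff, graft]
  constructor
  · intro h
    refine ⟨fun d hd => by simpa using h _ (.branch List.mem_cons_self hd), ?_⟩
    rcases us with _ | ⟨v, vs⟩
    · exact Or.inr rfl
    · refine Or.inl fun d hd => ?_
      cases hd with
      | branch hm hd => exact h _ (.branch (List.mem_cons_of_mem _ hm) hd)
  · rintro ⟨h1, h2⟩ d hd
    cases hd with
    | branch hm hd =>
      rcases List.mem_cons.1 hm with rfl | hm
      · exact Nat.succ_le_succ (h1 _ hd)
      · rcases h2 with h2 | h2
        · exact h2 _ (.branch hm hd)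
        · simp only [single, node.injEq] at h2
          simp [h2] at hm

/-- The finite set of plane trees with `n` vertices. -/
noncomputable def finsetOfSize (n : ℕ) : Finset PlaneTree := (finite_ofSize n).toFinset

theorem mem_finsetOfSize {n : ℕ} {t : PlaneTree} : t ∈ finsetOfSize n ↔ t.numVertices = n := by
  simp [finsetOfSize, ofSize]

open Classical in
/-- The number of plane trees with `n` vertices that satisfy `p`. -/
noncomputable def countWhere (p : PlaneTree → Prop) (n : ℕ) : ℕ :=
  ((finsetOfSize n).filter p).card

theorem countWhere_eq (p : PlaneTree → Prop) [DecidablePred p] (n : ℕ) :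
    countWhere p n = ((finsetOfSize n).filter p).card := by
  unfold countWhere
  congr

/-- The ordinary generating function, by number of vertices, of the plane trees satisfying `p`. -/
noncomputable def genFun (p : PlaneTree → Prop) : PowerSeries ℝ :=
  PowerSeries.mk fun n => (countWhere p n : ℝ)

theorem coeff_genFun (p : PlaneTree → Prop) (n : ℕ) : coeff n (genFun p) = countWhere p n := by
  simp [genFun]

theorem genFun_congr {p q : PlaneTree → Prop} (h : ∀ t, p t ↔ q t) : genFun p = genFun q := by
  rw [show p = q from funext fun t => propext (h t)]

theorem genFun_graft {p q r : PlaneTree → Prop} (h0 : ¬ r single)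
    (h : ∀ t u, r (graft t u) ↔ p t ∧ q u) : genFun r = genFun p * genFun q := by
  classical
  ext n
  rw [coeff_mul]
  simp only [coeff_genFun, countWhere_eq]
  norm_cast
  simp only [← Finset.card_product]
  rw [← Finset.card_sigma]
  symm
  refine Finset.card_bij (fun x _ => graft x.2.1 x.2.2) ?_ ?_ ?_
  · rintro ⟨⟨a, b⟩, t, u⟩ hx
    simp only [Finset.mem_sigma, Finset.mem_product, Finset.mem_filter,
      mem_finsetOfSize] at hx ⊢
    obtain ⟨hab, ⟨ht, hp⟩, hu, hq⟩ := hx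
    exact ⟨by rw [numVertices_graft, ht, hu, Finset.HasAntidiagonal.mem_antidiagonal.1 hab], (h t u).2 ⟨hp, hq⟩⟩
  · rintro ⟨⟨a, b⟩, t, u⟩ hx ⟨⟨a', b'⟩, t', u'⟩ hx' hg
    simp only [Finset.mem_sigma, Finset.mem_product, Finset.mem_filter,
      mem_finsetOfSize] at hx hx'
    obtain ⟨rfl, rfl⟩ := graft_injective hg
    obtain ⟨-, ⟨rfl, -⟩, rfl, -⟩ := hx
    obtain ⟨-, ⟨rfl, -⟩, rfl, -⟩ := hx'
    rfl
  · intro s hs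
    rw [Finset.mem_filter, mem_finsetOfSize] at hs
    rcases single_or_graft s with rfl | ⟨t, u, rfl⟩
    · exact absurd hs.2 h0
    · rw [h, numVertices_graft] at hs
      exact ⟨⟨(t.numVertices, u.numVertices), t, u⟩, by
        simp [mem_finsetOfSize, hs.1, hs.2.1, hs.2.2], rfl⟩

theorem genFun_or_single {p : PlaneTree → Prop} (h0 : ¬ p single) :
    genFun (fun t => p t ∨ t = single) = genFun p + X := by
  classical
  ext n
  rw [map_add, coeff_X, coeff_genFun, coeff_genFun, countWhere_eq, countWhere_eq, Finset.filter_or,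
    Finset.card_union_of_disjoint]
  · have : (finsetOfSize n).filter (fun t => t = single) = if n = 1 then {single} else ∅ := by
      ext t
      rw [Finset.mem_filter, mem_finsetOfSize]
      split_ifs with hn
      · rw [Finset.mem_singleton]
        refine ⟨fun h => h.2, ?_⟩
        rintro rfl
        exact ⟨numVertices_single.trans hn.symm, rfl⟩
      · simp only [Finset.notMem_empty, iff_false, not_and]
        rintro h rfl
        exact hn (h.symm.trans numVertices_single)
    rw [this]
    split_ifs <;> simp
  · rw [Finset.disjoint_filter]
    rintro t - hp rfl
    exact h0 hp

/-- The generating function of the plane trees with protection number at least `k`. -/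
noncomputable def tailGenFun (k : ℕ) : PowerSeries ℝ :=
  genFun fun t => k ≤ t.protectionNumber

theorem tailGenFun_zero : tailGenFun 0 = X + tailGenFun 0 ^ 2 := by
  have h1 : genFun (fun t => t ≠ single) = tailGenFun 0 * tailGenFun 0 :=
    genFun_graft (by simp) fun t u => by simp [graft_ne_single]
  have h2 := genFun_or_single (p := fun t => t ≠ single) (by simp)
  rw [h1] at h2
  rw [sq, add_comm, ← h2]
  exact genFun_congr fun t => by simp [em']

theorem tailGenFun_succ (k : ℕ) :
    tailGenFun (k + 1) = tailGenFun k * (tailGenFun (k + 1) + X) := by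
  have h0 : ¬ k + 1 ≤ single.protectionNumber := by simp [protectionNumber_single]
  have h2 := genFun_or_single (p := fun t => k + 1 ≤ t.protectionNumber) h0
  have h1 := genFun_graft (r := fun t => k + 1 ≤ t.protectionNumber)
    (p := fun t => k ≤ t.protectionNumber)
    (q := fun t => k + 1 ≤ t.protectionNumber ∨ t = single) h0
    fun t u => succ_le_protectionNumber_graft
  rw [h2] at h1
  exact h1

end PlaneTree

/-! ### Explicit solution of the recursion -/

namespace PlaneTree

open PowerSeries

/-- The map `G ↦ X G / (1 - G)` has fixed points `0` and `1 - X`, and it multiplies `G / (1 - X -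
G)` by `X`. Iterating from `T` and clearing denominators gives this identity. -/
theorem tailGenFun_mul_eq (k : ℕ) :
    tailGenFun k * (1 - X - (1 - X ^ k) * tailGenFun 0) = X ^ k * (1 - X) * tailGenFun 0 := by
  induction k with
  | zero => ring
  | succ k ih =>
    have h := tailGenFun_succ k
    linear_combination (tailGenFun (k + 1) + X) * ih +
      (1 - X - (1 - X ^ k) * tailGenFun 0) * h

/-- The denominator of the generating function of trees with protection number at least `m + 2`,
as an element of the quadratic extension generated by the generating function of all trees. -/
noncomputable def denom (m : ℕ) : PowerSeries ℝ := 1 + X ^ m * (1 - 3 * X) + X ^ (2 * m + 3)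

/-- The factor of `tailGenFun k` in `tailGenFun_mul_eq`, times its conjugate under `T ↦ 1 - T`,
equals `X ^ 2 * denom m` for `k = m + 2`; hence the shift by two. The relation for `T` serves to
reduce `T ^ 2`. -/
theorem tailGenFun_mul_denom (m : ℕ) :
    tailGenFun (m + 2) * denom m =
      X ^ m * (1 - X) * ((1 - X) * tailGenFun 0 - (1 - X ^ (m + 2)) * X) := by
  have h0 := tailGenFun_zero
  have h := tailGenFun_mul_eq (m + 2)
  have hX : (X ^ 2 : PowerSeries ℝ) ≠ 0 := pow_ne_zero _ X_ne_zero
  refine mul_left_cancel₀ hX ?_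
  unfold denom
  set T := tailGenFun 0
  set G := tailGenFun (m + 2)
  linear_combination (1 - X - (1 - X ^ (m + 2)) * (1 - T)) * h +
    (-G * (1 - X ^ (m + 2)) ^ 2 - X ^ (m + 2) * (1 - X) * (1 - X ^ (m + 2))) * h0

theorem constantCoeff_denom_ne_zero (m : ℕ) : constantCoeff (denom m) ≠ 0 := by
  rcases m with _ | m <;> simp [denom]

/-- The coefficient of the generating function of all trees in the one of trees with protection
number at least `m + 2`, up to the factor `X ^ m`. -/
noncomputable def mainFactor (m : ℕ) : PowerSeries ℝ := (1 - X) ^ 2 * (denom m)⁻¹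

/-- The part of the generating function of trees with protection number at least `m + 2` that is
analytic at the dominant singularity, up to the factor `X ^ m`. -/
noncomputable def regularPart (m : ℕ) : PowerSeries ℝ :=
  -(X * (1 - X) * (1 - X ^ (m + 2)) * (denom m)⁻¹)

theorem tailGenFun_eq (m : ℕ) :
    tailGenFun (m + 2) = X ^ m * mainFactor m * tailGenFun 0 + X ^ m * regularPart m := by
  have h := tailGenFun_mul_denom m
  have hd := PowerSeries.mul_inv_cancel (denom m) (constantCoeff_denom_ne_zero m)
  unfold mainFactor regularPart
  linear_combination (denom m)⁻¹ * h - tailGenFun (m + 2) * hd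

theorem tailGenFun_one : tailGenFun 1 = tailGenFun 0 - X := by
  have h0 := tailGenFun_zero
  have h1 := tailGenFun_succ 0
  have hne : (1 - tailGenFun 0 : PowerSeries ℝ) ≠ 0 := by
    intro h
    have h2 : tailGenFun 0 = 1 := (sub_eq_zero.1 h).symm
    rw [h2] at h0
    have := congrArg (coeff 1) h0
    simp [coeff_one] at this
  refine mul_left_cancel₀ hne ?_
  linear_combination h1 - h0

theorem coeff_zero_tailGenFun_zero : coeff 0 (tailGenFun 0) = 0 := by
  rw [tailGenFun, coeff_genFun, countWhere_eq]
  norm_cast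
  rw [Finset.card_eq_zero, Finset.filter_eq_empty_iff]
  intro t ht
  exact absurd (mem_finsetOfSize.1 ht) (numVertices_pos t).ne'

theorem coeff_succ_tailGenFun_zero (n : ℕ) : coeff (n + 1) (tailGenFun 0) = catalan n := by
  induction n using Nat.strong_induction_on with
  | _ n ih =>
    have h := congrArg (coeff (n + 1)) tailGenFun_zero
    rw [map_add, sq, coeff_mul, coeff_X, Finset.Nat.antidiagonal_succ, Finset.sum_cons,
      coeff_zero_tailGenFun_zero, zero_mul, zero_add, Finset.sum_map] at h
    rw [h]
    rcases n with _ | n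
    · simp [coeff_zero_tailGenFun_zero]
    · rw [Finset.Nat.antidiagonal_succ', Finset.sum_cons, catalan_succ', Finset.sum_map]
      simp only [Function.Embedding.prodMap, Function.Embedding.coeFn_mk, Prod.map,
        Function.Embedding.refl_apply, coeff_zero_tailGenFun_zero, Nat.succ_eq_add_one]
      push_cast
      simp only [mul_zero, zero_add]
      refine Finset.sum_congr rfl fun p hp => ?_
      have hp' := Finset.HasAntidiagonal.mem_antidiagonal.1 hp
      rw [ih p.1 (by omega), ih p.2 (by omega)]

end PlaneTree

/-! ### Truncated weighted `ℓ¹` norms -/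

namespace PowerSeries

/-- The partial sum of the first `J` terms of `∑ |f_j| ρ ^ j`. -/
noncomputable def weightedSum (ρ : ℝ) (J : ℕ) (f : PowerSeries ℝ) : ℝ :=
  ∑ j ∈ Finset.range J, |coeff j f| * ρ ^ j

variable {ρ : ℝ}

theorem weightedSum_nonneg (hρ : 0 ≤ ρ) (J : ℕ) (f : PowerSeries ℝ) : 0 ≤ weightedSum ρ J f :=
  Finset.sum_nonneg fun _ _ => by positivity

theorem weightedSum_neg (J : ℕ) (f : PowerSeries ℝ) :
    weightedSum ρ J (-f) = weightedSum ρ J f := by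
  simp [weightedSum]

theorem weightedSum_add_le (hρ : 0 ≤ ρ) (J : ℕ) (f g : PowerSeries ℝ) :
    weightedSum ρ J (f + g) ≤ weightedSum ρ J f + weightedSum ρ J g := by
  rw [weightedSum, weightedSum, weightedSum, ← Finset.sum_add_distrib]
  refine Finset.sum_le_sum fun j _ => ?_
  rw [map_add, ← add_mul]
  exact mul_le_mul_of_nonneg_right (abs_add_le _ _) (by positivity)

theorem weightedSum_sub_le (hρ : 0 ≤ ρ) (J : ℕ) (f g : PowerSeries ℝ) :
    weightedSum ρ J (f - g) ≤ weightedSum ρ J f + weightedSum ρ J g := by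
  rw [sub_eq_add_neg, ← weightedSum_neg J g]
  exact weightedSum_add_le hρ J f (-g)

/-- Truncation costs nothing: pairs with sum below `J` lie in the square of pairs with both entries
below `J`. -/
theorem weightedSum_mul_le (hρ : 0 ≤ ρ) (J : ℕ) (f g : PowerSeries ℝ) :
    weightedSum ρ J (f * g) ≤ weightedSum ρ J f * weightedSum ρ J g := by
  set F : ℕ × ℕ → ℝ := fun p => (|coeff p.1 f| * ρ ^ p.1) * (|coeff p.2 g| * ρ ^ p.2) with hF
  have hF0 : ∀ p, 0 ≤ F p := fun p => by positivity
  calc weightedSum ρ J (f * g)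
      ≤ ∑ n ∈ Finset.range J, ∑ p ∈ Finset.HasAntidiagonal.antidiagonal n, F p := by
        refine Finset.sum_le_sum fun n _ => ?_
        rw [coeff_mul]
        refine (mul_le_mul_of_nonneg_right (Finset.abs_sum_le_sum_abs _ _)
          (by positivity)).trans_eq ?_
        rw [Finset.sum_mul]
        refine Finset.sum_congr rfl fun p hp => ?_
        rw [← Finset.HasAntidiagonal.mem_antidiagonal.1 hp, hF, abs_mul, pow_add]
        ring
    _ = ∑ p ∈ (Finset.range J).biUnion Finset.HasAntidiagonal.antidiagonal, F p := by
        rw [Finset.sum_biUnion]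
        intro a _ b _ hab
        refine Finset.disjoint_left.2 fun p hp hq => hab ?_
        rw [← Finset.HasAntidiagonal.mem_antidiagonal.1 hp,
          ← Finset.HasAntidiagonal.mem_antidiagonal.1 hq]
    _ ≤ ∑ p ∈ Finset.range J ×ˢ Finset.range J, F p := by
        refine Finset.sum_le_sum_of_subset_of_nonneg ?_ fun p _ _ => hF0 p
        intro p hp
        obtain ⟨n, hn, hp⟩ := Finset.mem_biUnion.1 hp
        have := Finset.HasAntidiagonal.mem_antidiagonal.1 hp
        rw [Finset.mem_range] at hn
        rw [Finset.mem_product, Finset.mem_range, Finset.mem_range]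
        omega
    _ = weightedSum ρ J f * weightedSum ρ J g := by
        rw [Finset.sum_product, weightedSum, weightedSum, Finset.sum_mul_sum]

theorem weightedSum_X_pow_le (hρ : 0 ≤ ρ) (J m : ℕ) :
    weightedSum ρ J ((X : PowerSeries ℝ) ^ m) ≤ ρ ^ m := by
  simp only [weightedSum, coeff_X_pow]
  calc _ = ∑ j ∈ Finset.range J, if j = m then ρ ^ m else 0 := by
        refine Finset.sum_congr rfl fun j _ => ?_
        split_ifs with h <;> simp [h]
    _ ≤ ρ ^ m := by
        rw [Finset.sum_ite_eq']
        split_ifs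
        · exact le_rfl
        · positivity

theorem weightedSum_X_le (hρ : 0 ≤ ρ) (J : ℕ) : weightedSum ρ J (X : PowerSeries ℝ) ≤ ρ := by
  simpa using weightedSum_X_pow_le hρ J 1

theorem weightedSum_one_le (hρ : 0 ≤ ρ) (J : ℕ) : weightedSum ρ J (1 : PowerSeries ℝ) ≤ 1 := by
  simpa using weightedSum_X_pow_le hρ J 0

theorem weightedSum_C_mul (c : ℝ) (J : ℕ) (f : PowerSeries ℝ) :
    weightedSum ρ J (C c * f) = |c| * weightedSum ρ J f := by
  simp [weightedSum, abs_mul, Finset.mul_sum, mul_assoc]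

theorem weightedSum_mul_le_of_le (hρ : 0 ≤ ρ) {J : ℕ} {f g : PowerSeries ℝ} {a b : ℝ}
    (hf : weightedSum ρ J f ≤ a) (hg : weightedSum ρ J g ≤ b) :
    weightedSum ρ J (f * g) ≤ a * b :=
  (weightedSum_mul_le hρ J f g).trans
    (mul_le_mul hf hg (weightedSum_nonneg hρ J g) ((weightedSum_nonneg hρ J f).trans hf))

theorem abs_coeff_le_of_weightedSum_le {f : PowerSeries ℝ} {K : ℝ}
    (hρ : 0 ≤ ρ) (h : ∀ J, weightedSum ρ J f ≤ K) (n : ℕ) : |coeff n f| * ρ ^ n ≤ K :=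
  (Finset.single_le_sum (f := fun j => |coeff j f| * ρ ^ j) (fun _ _ => by positivity)
    (Finset.mem_range.2 n.lt_succ_self)).trans (h (n + 1))

theorem summable_of_weightedSum_le {f : PowerSeries ℝ} {K : ℝ}
    (hρ : 0 ≤ ρ) (h : ∀ J, weightedSum ρ J f ≤ K) : Summable fun j => |coeff j f| * ρ ^ j :=
  summable_of_sum_range_le (fun _ => by positivity) h

theorem tsum_le_of_weightedSum_le {f : PowerSeries ℝ} {K : ℝ}
    (hρ : 0 ≤ ρ) (h : ∀ J, weightedSum ρ J f ≤ K) : ∑' j, |coeff j f| * ρ ^ j ≤ K :=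
  Real.tsum_le_of_sum_range_le (fun _ => by positivity) h

end PowerSeries

/-! ### Norm bounds at radius `1 / 3`, uniform in `m` -/

namespace PlaneTree

open PowerSeries

theorem weightedSum_one_sub_X_le (J : ℕ) :
    weightedSum (1 / 3) J (1 - X : PowerSeries ℝ) ≤ 4 / 3 := by
  have hρ : (0 : ℝ) ≤ 1 / 3 := by norm_num
  linarith [weightedSum_sub_le hρ J (1 : PowerSeries ℝ) X, weightedSum_one_le hρ J,
    weightedSum_X_le hρ J]

/-- The equation `denom m * U = 1` bounds the norm of `U` by a constant plus a fraction of itself.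
Partial sums are finite, so this can be solved without knowing convergence beforehand. -/
theorem weightedSum_inv_denom_le (m J : ℕ) : weightedSum (1 / 3) J (denom m)⁻¹ ≤ 4 := by
  have hρ : (0 : ℝ) ≤ 1 / 3 := by norm_num
  have hd := PowerSeries.mul_inv_cancel (denom m) (constantCoeff_denom_ne_zero m)
  set U := (denom m)⁻¹
  have hU := weightedSum_nonneg hρ J U
  have h1 := weightedSum_one_le hρ J
  have hX := weightedSum_mul_le_of_le hρ (weightedSum_X_le hρ J) (le_refl (weightedSum (1 / 3) J U))
  rcases m with _ | m
  -- For `m = 0` the denominator is `2 - 3X + X ^ 3`. Its constant term `2` exceeds `1 + 1/27`, the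
  -- norm of the rest.
  · have e : C (2 : ℝ) * U = 1 + C (3 : ℝ) * (X * U) - X ^ 3 * U := by
      simp only [map_ofNat]
      rw [← hd, denom]
      ring
    have h2 := weightedSum_C_mul (ρ := 1 / 3) 2 J U
    have h3 := weightedSum_C_mul (ρ := 1 / 3) 3 J (X * U)
    have h4 := weightedSum_mul_le_of_le hρ (weightedSum_X_pow_le hρ J 3)
      (le_refl (weightedSum (1 / 3) J U))
    have h5 := weightedSum_sub_le hρ J (1 + C (3 : ℝ) * (X * U)) (X ^ 3 * U)
    have h6 := weightedSum_add_le hρ J 1 (C (3 : ℝ) * (X * U))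
    rw [e] at h2
    norm_num at h2 h3 h4
    linarith
  -- For positive exponent the two perturbations have norm at most `2/3` and `1/243`, with sum below
  -- one.
  · have e : U = 1 - X ^ (m + 1) * (U - C (3 : ℝ) * (X * U)) - X ^ (2 * (m + 1) + 3) * U := by
      simp only [map_ofNat]
      rw [← hd, denom]
      ring
    have h3 := weightedSum_C_mul (ρ := 1 / 3) 3 J (X * U)
    have hp : (1 / 3 : ℝ) ^ (m + 1) ≤ 1 / 3 := by
      simpa using pow_le_pow_of_le_one hρ (by norm_num) (Nat.le_add_left 1 m)
    have hp' : (1 / 3 : ℝ) ^ (2 * (m + 1) + 3) ≤ 1 / 243 := by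
      refine (pow_le_pow_of_le_one hρ (by norm_num) (by omega : 5 ≤ 2 * (m + 1) + 3)).trans ?_
      norm_num
    have h4 := weightedSum_mul_le_of_le hρ ((weightedSum_X_pow_le hρ J (2 * (m + 1) + 3)).trans hp')
      (le_refl (weightedSum (1 / 3) J U))
    have h7 := weightedSum_sub_le hρ J U (C (3 : ℝ) * (X * U))
    have h8 : weightedSum (1 / 3) J (U - C (3 : ℝ) * (X * U)) ≤ 2 * weightedSum (1 / 3) J U := by
      norm_num at h3
      linarith
    have h9 := weightedSum_mul_le_of_le hρ ((weightedSum_X_pow_le hρ J (m + 1)).trans hp) h8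
    have h5 := weightedSum_sub_le hρ J (1 - X ^ (m + 1) * (U - C (3 : ℝ) * (X * U)))
      (X ^ (2 * (m + 1) + 3) * U)
    have h6 := weightedSum_sub_le hρ J 1 (X ^ (m + 1) * (U - C (3 : ℝ) * (X * U)))
    rw [← e] at h5
    linarith

theorem weightedSum_X_pow_mul_mainFactor_le (m J : ℕ) :
    weightedSum (1 / 3) J (X ^ m * mainFactor m) ≤ 8 * (1 / 3) ^ m := by
  have hρ : (0 : ℝ) ≤ 1 / 3 := by norm_num
  have h1 := weightedSum_one_sub_X_le J
  have h2 := weightedSum_mul_le_of_le hρ (weightedSum_X_pow_le hρ J m) (weightedSum_mul_le_of_le hρ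
    (weightedSum_mul_le_of_le hρ h1 h1) (weightedSum_inv_denom_le m J))
  rw [mainFactor, sq]
  refine h2.trans ?_
  have : (0 : ℝ) ≤ (1 / 3) ^ m := by positivity
  linarith

theorem weightedSum_X_pow_mul_regularPart_le (m J : ℕ) :
    weightedSum (1 / 3) J (X ^ m * regularPart m) ≤ 4 * (1 / 3) ^ m := by
  have hρ : (0 : ℝ) ≤ 1 / 3 := by norm_num
  have h1 := weightedSum_one_sub_X_le J
  have h3 : weightedSum (1 / 3) J (1 - X ^ (m + 2) : PowerSeries ℝ) ≤ 2 := by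
    have hp : (1 / 3 : ℝ) ^ (m + 2) ≤ 1 := pow_le_one₀ hρ (by norm_num)
    linarith [weightedSum_sub_le hρ J (1 : PowerSeries ℝ) (X ^ (m + 2)), weightedSum_one_le hρ J,
      weightedSum_X_pow_le hρ J (m + 2)]
  have h2 := weightedSum_mul_le_of_le hρ (weightedSum_X_pow_le hρ J m) (weightedSum_mul_le_of_le hρ
    (weightedSum_mul_le_of_le hρ (weightedSum_mul_le_of_le hρ (weightedSum_X_le hρ J) h1) h3)
    (weightedSum_inv_denom_le m J))
  rw [regularPart, mul_neg, weightedSum_neg]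
  refine h2.trans ?_
  have : (0 : ℝ) ≤ (1 / 3) ^ m := by positivity
  linarith

end PlaneTree

/-! ### Ratios of Catalan numbers to second order -/

namespace PlaneTree

open PowerSeries

/-- The number of plane trees with `n` vertices, as a real number. -/
noncomputable def treeCount (n : ℕ) : ℝ := coeff n (tailGenFun 0)

theorem treeCount_zero : treeCount 0 = 0 := coeff_zero_tailGenFun_zero

theorem treeCount_one : treeCount 1 = 1 := by
  simp [treeCount, coeff_succ_tailGenFun_zero 0]

theorem treeCount_rec (p : ℕ) :
    ((p : ℝ) + 2) * treeCount (p + 2) = (4 * p + 2) * treeCount (p + 1) := by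
  rw [treeCount, treeCount, coeff_succ_tailGenFun_zero, coeff_succ_tailGenFun_zero]
  have h1 := succ_mul_catalan_eq_centralBinom (p + 1)
  have h2 := succ_mul_catalan_eq_centralBinom p
  have h3 := Nat.succ_mul_centralBinom_succ p
  rw [← h1, ← h2] at h3
  have h4 : ((p + 1 : ℕ) : ℝ) * (((p + 1 + 1 : ℕ) : ℝ) * catalan (p + 1)) =
      2 * (2 * p + 1) * (((p + 1 : ℕ) : ℝ) * catalan p) := by exact_mod_cast h3
  have h5 : ((p + 1 : ℕ) : ℝ) ≠ 0 := by positivity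
  apply mul_left_cancel₀ h5
  push_cast at h4 ⊢
  linear_combination h4

theorem treeCount_pos {n : ℕ} (hn : 1 ≤ n) : 0 < treeCount n := by
  induction n, hn using Nat.le_induction with
  | base => simp [treeCount_one]
  | succ n hn ih =>
    obtain ⟨p, rfl⟩ : ∃ p, n = p + 1 := ⟨n - 1, by omega⟩
    have h := treeCount_rec p
    have h2 : 0 < (4 * (p : ℝ) + 2) * treeCount (p + 1) := by positivity
    rw [← h] at h2
    exact pos_of_mul_pos_right h2 (by positivity)

/-- The normalised ratio `4 ^ j * t_{n - j} / t_n` of numbers of plane trees, which is zero for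
`j > n`. -/
noncomputable def countRatio (n j : ℕ) : ℝ :=
  if j ≤ n then 4 ^ j * treeCount (n - j) / treeCount n else 0

theorem countRatio_zero {n : ℕ} (hn : 1 ≤ n) : countRatio n 0 = 1 := by
  simp [countRatio, (treeCount_pos hn).ne']

theorem countRatio_of_le {n j : ℕ} (h : n ≤ j) : countRatio n j = 0 := by
  rw [countRatio]
  split_ifs with h'
  · simp [le_antisymm h' h, treeCount_zero]
  · rfl

theorem countRatio_succ {n j : ℕ} (h : j + 2 ≤ n) :
    countRatio n (j + 1) * ((n : ℝ) - j - 3 / 2) = countRatio n j * (n - j) := by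
  obtain ⟨p, rfl⟩ : ∃ p, n = p + 2 + j := ⟨n - j - 2, by omega⟩
  rw [countRatio, countRatio, if_pos (by omega), if_pos (by omega),
    show p + 2 + j - (j + 1) = p + 1 by omega, show p + 2 + j - j = p + 2 by omega]
  have h := treeCount_rec p
  have hp := (treeCount_pos (show 1 ≤ p + 2 + j by omega)).ne'
  field_simp
  push_cast
  rw [pow_succ]
  linear_combination (-2 * (4 : ℝ) ^ j) * h

theorem countRatio_succ_eq {n j : ℕ} (h : j + 2 ≤ n) :
    countRatio n (j + 1) =
      countRatio n j + 3 / 2 * (countRatio n j * (1 / ((n : ℝ) - j - 3 / 2))) := by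
  have hs := countRatio_succ h
  have hn : (j : ℝ) + 2 ≤ n := by exact_mod_cast h
  have hy : (n : ℝ) - j - 3 / 2 ≠ 0 := by linarith
  have hd := one_div_mul_cancel hy
  apply mul_right_cancel₀ hy
  rw [hs]
  linear_combination (-(3 / 2) * countRatio n j) * hd

/-- Both bounds propagate through the recursion for `countRatio`. The product with `(n - j) ^ 2`
does not increase, which comes down to `n - j ≥ 2`. -/
theorem countRatio_bounds {n j : ℕ} (h : j + 1 ≤ n) :
    1 + 3 / 2 * (j / n : ℝ) ≤ countRatio n j ∧ countRatio n j * ((n : ℝ) - j) ^ 2 ≤ (n : ℝ) ^ 2 := by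
  induction j with
  | zero => simp [countRatio_zero h]
  | succ j ih =>
    obtain ⟨h1, h2⟩ := ih (by omega)
    have hs := countRatio_succ h
    have hd := countRatio_succ_eq h
    have hn : (j : ℝ) + 2 ≤ n := by exact_mod_cast h
    have hj : (0 : ℝ) ≤ j := by positivity
    set x := countRatio n j
    set x' := countRatio n (j + 1)
    have hn0 : (0 : ℝ) < n := by linarith
    have hy : (0 : ℝ) < n - j - 3 / 2 := by linarith
    have hx1 : 1 ≤ x := le_trans (by have : (0 : ℝ) ≤ j / n := by positivity
                                     linarith) h1
    push_cast
    constructor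
    · have : 1 / (n : ℝ) ≤ x * (1 / (n - j - 3 / 2)) := by
        rw [mul_one_div, div_le_div_iff₀ hn0 hy]
        nlinarith
      rw [hd, add_div]
      linarith
    · refine le_trans ?_ h2
      rw [← mul_le_mul_iff_left₀ hy]
      have e : x' * ((n : ℝ) - (j + 1)) ^ 2 * (n - j - 3 / 2) = x * (n - j) * (n - (j + 1)) ^ 2 := by
        linear_combination (n - (j + 1) : ℝ) ^ 2 * hs
      rw [e]
      have : (0 : ℝ) ≤ x * (n - j) * (((n : ℝ) - j) - 2) :=
        mul_nonneg (mul_nonneg (by linarith) (by linarith)) (by linarith)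
      linarith

theorem le_mul_sub_of_lt {n j : ℕ} (h : j + 1 ≤ n) : (n : ℝ) ≤ (1 + j) * (n - j) := by
  have hn : (j : ℝ) + 1 ≤ n := by exact_mod_cast h
  have : (0 : ℝ) ≤ j * (n - 1 - j) := mul_nonneg (by positivity) (by linarith)
  linarith

theorem countRatio_le_sq {n j : ℕ} (h : j + 1 ≤ n) : countRatio n j ≤ (1 + j) ^ 2 := by
  have h1 := le_mul_sub_of_lt h
  have h2 := (countRatio_bounds h).2
  have hn : (j : ℝ) + 1 ≤ n := by exact_mod_cast h
  have hj : (0 : ℝ) < n - j := by linarith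
  have h3 : (n : ℝ) ^ 2 ≤ ((1 + j) * (n - j)) ^ 2 := by gcongr
  rw [mul_pow] at h3
  exact le_of_mul_le_mul_right (h2.trans h3) (by positivity)

theorem inv_sub_le {n j : ℕ} (h : j + 2 ≤ n) :
    1 / ((n : ℝ) - j - 3 / 2) ≤ 4 * (1 + j) / n := by
  have h1 := le_mul_sub_of_lt (show j + 1 ≤ n by omega)
  have hn : (j : ℝ) + 2 ≤ n := by exact_mod_cast h
  have hj : (0 : ℝ) ≤ j := by positivity
  rw [div_le_div_iff₀ (by linarith) (by linarith)]
  nlinarith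

theorem countRatio_sub_one_le {n j : ℕ} (h : j + 1 ≤ n) :
    countRatio n j - 1 ≤ 6 * (1 + j) ^ 4 / n := by
  induction j with
  | zero => rw [countRatio_zero h, sub_self]; positivity
  | succ j ih =>
    have ih := ih (by omega)
    rw [countRatio_succ_eq h]
    have hn : (j : ℝ) + 2 ≤ n := by exact_mod_cast h
    have hj : (0 : ℝ) ≤ j := by positivity
    have h1 : countRatio n j * (1 / ((n : ℝ) - j - 3 / 2)) ≤ (1 + j) ^ 2 * (4 * (1 + j) / n) :=
      mul_le_mul (countRatio_le_sq (by omega)) (inv_sub_le h)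
        (one_div_nonneg.2 (by linarith)) (by positivity)
    have h2 : 6 * (1 + (j : ℝ)) ^ 4 / n + 3 / 2 * ((1 + j) ^ 2 * (4 * (1 + j) / n)) ≤
        6 * (1 + ((j + 1 : ℕ) : ℝ)) ^ 4 / n := by
      rw [show 6 * (1 + (j : ℝ)) ^ 4 / n + 3 / 2 * ((1 + j) ^ 2 * (4 * (1 + j) / n)) =
        (6 * (1 + (j : ℝ)) ^ 4 + 6 * (1 + j) ^ 3) / n by ring]
      gcongr
      push_cast
      have : 0 ≤ 6 * (3 * (1 + (j : ℝ)) ^ 3 + 6 * (1 + (j : ℝ)) ^ 2 + 4 * (1 + (j : ℝ)) + 1) := by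
        positivity
      linarith
    linarith

/-- Bootstrapping: the increment is `3/2 * x * d` with `d = 1 / (n - j - 3/2)`. The first-order
bound on `x - 1` and the bound on `d - 1/n` contribute `24` and `6`, and `3/2 * (24 + 6) = 45`. -/
theorem countRatio_sub_le {n j : ℕ} (h : j + 1 ≤ n) :
    countRatio n j - (1 + 3 / 2 * (j / n : ℝ)) ≤ 45 * (1 + j) ^ 6 / n ^ 2 := by
  induction j with
  | zero =>
    rw [countRatio_zero h]
    simp
    positivity
  | succ j ih =>
    have ih := ih (by omega)
    rw [countRatio_succ_eq h]
    have hn : (j : ℝ) + 2 ≤ n := by exact_mod_cast h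
    have hj : (0 : ℝ) ≤ j := by positivity
    have hn0 : (0 : ℝ) < n := by linarith
    have hy : (0 : ℝ) < n - j - 3 / 2 := by linarith
    have hd := inv_sub_le h
    set x := countRatio n j
    set d := 1 / ((n : ℝ) - j - 3 / 2) with hd_def
    have hd0 : 0 < d := by positivity
    have h1 : (x - 1) * d ≤ (6 * (1 + j) ^ 4 / n) * (4 * (1 + j) / n) :=
      mul_le_mul (countRatio_sub_one_le (by omega)) hd hd0.le (by positivity)
    have h2 : d - 1 / n ≤ 6 * (1 + j) ^ 5 / n ^ 2 := by
      have e : d - 1 / n = (j + 3 / 2) / n * d := by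
        have h3 : d * (n - j - 3 / 2) = 1 := one_div_mul_cancel hy.ne'
        field_simp
        linear_combination 2 * h3
      rw [e]
      calc (j + 3 / 2) / n * d ≤ (j + 3 / 2) / n * (4 * (1 + j) / n) := by gcongr
        _ = ((j + 3 / 2) * (4 * (1 + j))) / n ^ 2 := by ring
        _ ≤ 6 * (1 + j) ^ 5 / n ^ 2 := by
          refine div_le_div_of_nonneg_right ?_ (by positivity)
          have : (1 + (j : ℝ)) ^ 2 ≤ (1 + j) ^ 5 :=
            pow_le_pow_right₀ (by linarith) (by norm_num)
          nlinarith
    have h3 : 45 * (1 + (j : ℝ)) ^ 6 / n ^ 2 + 3 / 2 * ((6 * (1 + j) ^ 4 / n) * (4 * (1 + j) / n) +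
        6 * (1 + j) ^ 5 / n ^ 2) ≤ 45 * (1 + ((j + 1 : ℕ) : ℝ)) ^ 6 / n ^ 2 := by
      rw [show 45 * (1 + (j : ℝ)) ^ 6 / n ^ 2 + 3 / 2 * ((6 * (1 + j) ^ 4 / n) * (4 * (1 + j) / n) +
        6 * (1 + j) ^ 5 / n ^ 2) = (45 * (1 + (j : ℝ)) ^ 6 + 45 * (1 + j) ^ 5) / n ^ 2 by ring]
      gcongr
      push_cast
      have : 0 ≤ 45 * (5 * (1 + (j : ℝ)) ^ 5 + 15 * (1 + (j : ℝ)) ^ 4 + 20 * (1 + (j : ℝ)) ^ 3 +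
        15 * (1 + (j : ℝ)) ^ 2 + 6 * (1 + (j : ℝ)) + 1) := by positivity
      linarith
    have h4 : x + 3 / 2 * (x * d) - (1 + 3 / 2 * (((j + 1 : ℕ) : ℝ) / n)) =
        x - (1 + 3 / 2 * (j / n : ℝ)) + 3 / 2 * ((x - 1) * d + (d - 1 / n)) := by
      push_cast
      ring
    rw [h4]
    linarith

theorem abs_countRatio_sub_le {n : ℕ} (hn : 1 ≤ n) (j : ℕ) :
    |countRatio n j - (1 + 3 / 2 * (j / n : ℝ))| ≤ 45 * (1 + j) ^ 6 / n ^ 2 := by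
  have hn1 : (1 : ℝ) ≤ n := by exact_mod_cast hn
  rcases le_or_gt n j with h | h
  -- Here the ratio vanishes, but `j` is so large that the claimed bound exceeds the main term.
  · have hnj : (n : ℝ) ≤ j := by exact_mod_cast h
    rw [countRatio_of_le h, zero_sub, abs_neg, abs_of_nonneg (by positivity),
      le_div_iff₀ (by positivity)]
    have h1 : (j / n : ℝ) ≤ j := div_le_self (by positivity) hn1
    have h2 : (n : ℝ) ^ 2 ≤ (1 + j) ^ 2 := by gcongr; linarith
    have h3 : (1 + (j : ℝ)) ^ 3 ≤ (1 + j) ^ 6 := pow_le_pow_right₀ (by linarith) (by norm_num)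
    calc (1 + 3 / 2 * (j / n : ℝ)) * n ^ 2 ≤ (2 * (1 + j)) * (1 + j) ^ 2 := by
          gcongr
          linarith
      _ ≤ 45 * (1 + (j : ℝ)) ^ 6 := by nlinarith
  · rw [abs_of_nonneg (by linarith [(countRatio_bounds h).1])]
    exact countRatio_sub_le h

/-- The bound `countRatio_le_sq` at `j = n - 1`, where the remaining tree is a single vertex. -/
theorem four_pow_le_treeCount {n : ℕ} (hn : 1 ≤ n) : (4 : ℝ) ^ n ≤ 4 * n ^ 2 * treeCount n := by
  obtain ⟨p, rfl⟩ : ∃ p, n = p + 1 := ⟨n - 1, by omega⟩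
  have h := countRatio_le_sq (le_refl (p + 1))
  rw [countRatio, if_pos (by omega), Nat.add_sub_cancel_left, treeCount_one,
    div_le_iff₀ (treeCount_pos hn)] at h
  push_cast
  rw [pow_succ]
  linarith

end PlaneTree

/-! ### Values of power series and the Euler operator -/

namespace PowerSeries

/-- `f` converges absolutely at `r` and takes the value `v` there. -/
def HasValue (r : ℝ) (f : PowerSeries ℝ) (v : ℝ) : Prop :=
  (Summable fun j => ‖coeff j f * r ^ j‖) ∧ HasSum (fun j => coeff j f * r ^ j) v

variable {r v w : ℝ} {f g : PowerSeries ℝ}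

theorem HasValue.unique (hf : HasValue r f v) (hf' : HasValue r f w) : v = w :=
  hf.2.unique hf'.2

theorem HasValue.of_summable (h : Summable fun j => ‖coeff j f * r ^ j‖) :
    HasValue r f (∑' j, coeff j f * r ^ j) :=
  ⟨h, h.of_norm.hasSum⟩

theorem HasValue.neg (hf : HasValue r f v) : HasValue r (-f) (-v) :=
  ⟨by simpa using hf.1, by simpa using hf.2.neg⟩

theorem HasValue.add (hf : HasValue r f v) (hg : HasValue r g w) : HasValue r (f + g) (v + w) := by
  constructor
  · refine Summable.of_nonneg_of_le (fun _ => norm_nonneg _) (fun j => ?_) (hf.1.add hg.1)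
    rw [map_add, add_mul]
    exact norm_add_le _ _
  · simpa [add_mul] using hf.2.add hg.2

theorem HasValue.sub (hf : HasValue r f v) (hg : HasValue r g w) : HasValue r (f - g) (v - w) := by
  rw [sub_eq_add_neg, sub_eq_add_neg]
  exact hf.add hg.neg

theorem HasValue.mul (hf : HasValue r f v) (hg : HasValue r g w) : HasValue r (f * g) (v * w) := by
  have e : ∀ n, coeff n (f * g) * r ^ n = ∑ p ∈ Finset.HasAntidiagonal.antidiagonal n,
      (coeff p.1 f * r ^ p.1) * (coeff p.2 g * r ^ p.2) := by
    intro n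
    rw [coeff_mul, Finset.sum_mul]
    refine Finset.sum_congr rfl fun p hp => ?_
    rw [← Finset.HasAntidiagonal.mem_antidiagonal.1 hp, pow_add]
    ring
  have hs := summable_norm_sum_mul_antidiagonal_of_summable_norm hf.1 hg.1
  have ht := tsum_mul_tsum_eq_tsum_sum_antidiagonal_of_summable_norm hf.1 hg.1
  simp only [← e] at hs ht
  refine ⟨hs, ?_⟩
  rw [hf.2.tsum_eq, hg.2.tsum_eq] at ht
  rw [ht]
  exact hs.of_norm.hasSum

theorem HasValue.X_pow (r : ℝ) (m : ℕ) : HasValue r (X ^ m : PowerSeries ℝ) (r ^ m) := by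
  have h0 : ∀ j, j ≠ m → coeff j (X ^ m : PowerSeries ℝ) * r ^ j = 0 := fun j hj => by
    simp [coeff_X_pow, hj]
  constructor
  · exact summable_of_ne_finset_zero (s := {m}) fun j hj => by
      rw [h0 j (by simpa using hj), norm_zero]
  · simpa using hasSum_single (f := fun j => coeff j (X ^ m : PowerSeries ℝ) * r ^ j) m h0

theorem HasValue.X (r : ℝ) : HasValue r (X : PowerSeries ℝ) r := by
  simpa using HasValue.X_pow r 1

theorem HasValue.one (r : ℝ) : HasValue r (1 : PowerSeries ℝ) 1 := by
  simpa using HasValue.X_pow r 0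

theorem HasValue.C_mul (c : ℝ) (hf : HasValue r f v) : HasValue r (C c * f) (c * v) := by
  constructor
  · simpa [mul_assoc, abs_mul] using hf.1.mul_left |c|
  · simpa [mul_assoc] using hf.2.mul_left c

/-- The Euler operator `X * d/dX`. -/
noncomputable def euler (f : PowerSeries ℝ) : PowerSeries ℝ := PowerSeries.mk fun n => n * coeff n f

theorem coeff_euler (n : ℕ) (f : PowerSeries ℝ) : coeff n (euler f) = n * coeff n f := by
  simp [euler]

theorem euler_mul (f g : PowerSeries ℝ) : euler (f * g) = euler f * g + f * euler g := by
  ext n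
  simp only [coeff_euler, map_add, coeff_mul, ← Finset.sum_add_distrib, Finset.mul_sum]
  refine Finset.sum_congr rfl fun p hp => ?_
  rw [← Finset.HasAntidiagonal.mem_antidiagonal.1 hp]
  push_cast
  ring

theorem euler_add (f g : PowerSeries ℝ) : euler (f + g) = euler f + euler g := by
  ext n
  simp [coeff_euler, mul_add]

theorem euler_sub (f g : PowerSeries ℝ) : euler (f - g) = euler f - euler g := by
  ext n
  simp [coeff_euler, mul_sub]

theorem euler_X_pow (m : ℕ) : euler (X ^ m) = C (m : ℝ) * X ^ m := by
  ext n
  rw [coeff_euler, coeff_C_mul, coeff_X_pow]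
  split_ifs with h <;> simp [h]

theorem euler_X : euler X = X := by
  simpa using euler_X_pow 1

theorem euler_one : euler 1 = 0 := by
  simpa using euler_X_pow 0

theorem euler_C_mul (c : ℝ) (f : PowerSeries ℝ) : euler (C c * f) = C c * euler f := by
  ext n
  simp only [coeff_euler, coeff_C_mul]
  ring

end PowerSeries

/-! ### Value and derivative at the singularity `1 / 4` -/

namespace PlaneTree

open PowerSeries

theorem denom_eq (m : ℕ) :
    denom m = 1 + X ^ m * (1 - C (3 : ℝ) * X) + X ^ (2 * m + 3) := by
  rw [denom, map_ofNat]

theorem X_pow_mul_mainFactor_mul_denom (m : ℕ) :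
    X ^ m * mainFactor m * denom m = X ^ m * ((1 - X) * (1 - X)) := by
  have hd := PowerSeries.mul_inv_cancel (denom m) (constantCoeff_denom_ne_zero m)
  rw [mainFactor]
  linear_combination (X ^ m * (1 - X) ^ 2) * hd

/-- Evaluating the identity for `X ^ m * mainFactor m * denom m` and its Euler derivative at `1 / 4`
gives two linear equations for `v` and `w`. With `P = 4 ^ m`, the denominator takes the value `(8P +
1) ^ 2 / (64 P ^ 2)`. -/
theorem value_mainFactor {m : ℕ} {v w : ℝ} (hv : HasValue (1 / 4) (X ^ m * mainFactor m) v)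
    (hw : HasValue (1 / 4) (euler (X ^ m * mainFactor m)) w) :
    v = term0 (m + 2) ∧ 3 / 2 * w = term1 (m + 2) := by
  have hq := HasValue.X_pow (1 / 4) m
  have hX := HasValue.X (1 / 4)
  have h1 := HasValue.one (1 / 4)
  have hX2 := HasValue.X_pow (1 / 4) (2 * m + 3)
  have hd := (h1.add (hq.mul (h1.sub (hX.C_mul 3)))).add hX2
  rw [← denom_eq] at hd
  have e := X_pow_mul_mainFactor_mul_denom m
  have e' := congrArg euler e
  rw [euler_mul, denom_eq, euler_add, euler_add, euler_mul (X ^ m) (1 - C (3 : ℝ) * X),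
    euler_mul (X ^ m) ((1 - X) * (1 - X)), euler_mul (1 - X) (1 - X), euler_sub, euler_sub,
    euler_C_mul, euler_X, euler_one, euler_X_pow, euler_X_pow, ← denom_eq, zero_add, zero_sub,
    zero_sub] at e'
  have a1 := hv.mul hd
  rw [e] at a1
  have a2 := a1.unique (hq.mul ((h1.sub hX).mul (h1.sub hX)))
  have b1 := (hw.mul hd).add (hv.mul ((((hq.C_mul m).mul (h1.sub (hX.C_mul 3))).add
    (hq.mul (hX.C_mul 3).neg)).add (hX2.C_mul ((2 * m + 3 : ℕ) : ℝ))))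
  rw [e'] at b1
  have b2 := b1.unique (((hq.C_mul m).mul ((h1.sub hX).mul (h1.sub hX))).add
    (hq.mul ((hX.neg.mul (h1.sub hX)).add ((h1.sub hX).mul hX.neg))))
  have hP : (0 : ℝ) < 4 ^ m := by positivity
  have p1 : (1 / 4 : ℝ) ^ m = 1 / 4 ^ m := by rw [one_div_pow]
  have p2 : (1 / 4 : ℝ) ^ (2 * m + 3) = 1 / (4 ^ m) ^ 2 / 64 := by
    rw [one_div_pow, pow_add, mul_comm 2 m, pow_mul]
    field_simp
    norm_num
  rw [p1, p2] at a2 b2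
  have p3 : (4 : ℝ) ^ (m + 2) = 16 * 4 ^ m := by rw [pow_add]; ring
  have p4 : (4 : ℝ) ^ (2 * (m + 2)) = (16 * 4 ^ m) ^ 2 := by rw [← p3, ← pow_mul, mul_comm]
  rw [term0, term1, p4, p3]
  push_cast at b2 ⊢
  generalize (4 : ℝ) ^ m = P at *
  have hne : 8 * P + 1 ≠ 0 := by positivity
  have hv' : v = 9 * (16 * P) / (16 * P + 2) ^ 2 := by
    rw [eq_div_iff (by positivity)]
    field_simp at a2
    linear_combination (1 / 4) * a2
  refine ⟨hv', ?_⟩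
  have hw' : w * (64 * P ^ 2 + 16 * P + 1) = 36 * P * m - 24 * P -
      v * (16 * P * m - 48 * P + 2 * m + 3) := by
    field_simp at b2
    linear_combination (1 / 16) * b2
  rw [hv'] at hw'
  have h64 : 64 * P ^ 2 + 16 * P + 1 ≠ 0 := by positivity
  rw [eq_div_of_mul_eq h64 hw']
  field_simp
  ring

end PlaneTree

/-! ### Second-order expansion of the tail probabilities -/

namespace PlaneTree

open PowerSeries

theorem exists_bound_pow_mul_geometric (d : ℕ) :
    ∃ B : ℝ, 0 ≤ B ∧ ∀ j : ℕ, (1 + (j : ℝ)) ^ d * (3 / 4) ^ j ≤ B := by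
  have h := tendsto_pow_const_mul_const_pow_of_abs_lt_one d
    (show |(3 / 4 : ℝ)| < 1 by rw [abs_of_pos] <;> norm_num)
  have h' := (tendsto_add_atTop_iff_nat 1).2 h
  obtain ⟨B, hB⟩ := h'.bddAbove_range
  have hB' : ∀ j : ℕ, (1 + (j : ℝ)) ^ d * (3 / 4) ^ j ≤ 4 / 3 * B := fun j => by
    have := hB ⟨j, rfl⟩
    simp only [Nat.cast_add, Nat.cast_one, pow_succ] at this
    rw [add_comm]
    linarith
  exact ⟨4 / 3 * B, le_trans (by positivity) (hB' 0), hB'⟩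

/-- A power series bounded in the weighted `ℓ¹` norm with `ρ = 1 / 3` has, against the numbers of
plane trees, coefficients given to second order by its value and derivative at `1 / 4`. -/
theorem exists_coeff_mul_tailGenFun_zero_expansion :
    ∃ A : ℝ, ∀ (S : PowerSeries ℝ) (K : ℝ), (∀ J, weightedSum (1 / 3) J S ≤ K) →
      ∃ v w, HasValue (1 / 4) S v ∧ HasValue (1 / 4) (euler S) w ∧ ∀ n : ℕ, 1 ≤ n →
        |coeff n (S * tailGenFun 0) / treeCount n - (v + 3 / 2 * w / n)| ≤ A * K / n ^ 2 := by
  obtain ⟨B, hB0, hB⟩ := exists_bound_pow_mul_geometric 6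
  refine ⟨45 * B, fun S K hK => ?_⟩
  have hρ : (0 : ℝ) ≤ 1 / 3 := by norm_num
  have hsum := summable_of_weightedSum_le hρ hK
  have hle := tsum_le_of_weightedSum_le hρ hK
  -- The gap between radii `1 / 4` and `1 / 3` absorbs the factor `(1 + j) ^ 6` of the ratio
  -- estimate.
  have hpow : ∀ j : ℕ, (1 / 4 : ℝ) ^ j = (3 / 4) ^ j * (1 / 3) ^ j := fun j => by
    rw [← mul_pow]; norm_num
  have hdom : ∀ j : ℕ, |coeff j S| * (1 / 4) ^ j * (1 + (j : ℝ)) ^ 6 ≤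
      B * (|coeff j S| * (1 / 3) ^ j) := fun j => by
    rw [hpow]
    have := mul_le_mul_of_nonneg_right (hB j)
      (show 0 ≤ |coeff j S| * (1 / 3 : ℝ) ^ j by positivity)
    linarith
  have hdomS : Summable fun j : ℕ => |coeff j S| * (1 / 4) ^ j * (1 + (j : ℝ)) ^ 6 :=
    Summable.of_nonneg_of_le (fun _ => by positivity) hdom (hsum.mul_left B)
  have hS : Summable fun j => ‖coeff j S * (1 / 4) ^ j‖ := by
    refine Summable.of_nonneg_of_le (fun _ => norm_nonneg _) (fun j => ?_) hdomS
    rw [Real.norm_eq_abs, abs_mul, abs_of_nonneg (by positivity : (0 : ℝ) ≤ (1 / 4) ^ j)]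
    exact le_mul_of_one_le_right (by positivity) (one_le_pow₀ (by simp))
  have hE : Summable fun j => ‖coeff j (euler S) * (1 / 4) ^ j‖ := by
    refine Summable.of_nonneg_of_le (fun _ => norm_nonneg _) (fun j => ?_) hdomS
    rw [Real.norm_eq_abs, coeff_euler, abs_mul, abs_mul,
      abs_of_nonneg (by positivity : (0 : ℝ) ≤ (1 / 4) ^ j), Nat.abs_cast, mul_assoc, mul_comm]
    refine mul_le_mul_of_nonneg_left ?_ (by positivity)
    calc (j : ℝ) ≤ 1 + j := by linarith
      _ ≤ (1 + (j : ℝ)) ^ 6 := le_self_pow₀ (by simp) (by norm_num)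
  have hv := HasValue.of_summable hS
  have hw := HasValue.of_summable hE
  refine ⟨_, _, hv, hw, fun n hn => ?_⟩
  have hn0 : (0 : ℝ) < n := by exact_mod_cast hn
  set v := ∑' j, coeff j S * (1 / 4) ^ j
  set w := ∑' j, coeff j (euler S) * (1 / 4) ^ j
  have hT := (treeCount_pos hn).ne'
  have h1 : HasSum (fun j => coeff j S * (1 / 4) ^ j * countRatio n j)
      (coeff n (S * tailGenFun 0) / treeCount n) := by
    have e : coeff n (S * tailGenFun 0) / treeCount n =
        ∑ j ∈ Finset.range (n + 1), coeff j S * (1 / 4) ^ j * countRatio n j := by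
      rw [coeff_mul, Finset.Nat.sum_antidiagonal_eq_sum_range_succ
        (fun i j => coeff i S * coeff j (tailGenFun 0)), Finset.sum_div]
      refine Finset.sum_congr rfl fun j hj => ?_
      rw [countRatio, if_pos (by simpa [Nat.lt_succ_iff] using hj), one_div_pow, ← treeCount]
      field_simp
    rw [e]
    refine hasSum_sum_of_ne_finset_zero fun j hj => ?_
    rw [countRatio_of_le (by simp at hj; omega), mul_zero]
  have h2 : HasSum (fun j : ℕ => coeff j S * (1 / 4) ^ j * (1 + 3 / 2 * (j / n : ℝ)))
      (v + 3 / 2 * w / n) := by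
    have h3 := hv.2.add (hw.2.mul_left (3 / 2 / (n : ℝ)))
    rw [show v + 3 / 2 * w / n = v + 3 / 2 / (n : ℝ) * w by ring]
    convert h3 using 2 with j
    rw [coeff_euler]
    ring
  have h3 := h1.sub h2
  rw [← h3.tsum_eq, ← Real.norm_eq_abs]
  have hb : ∀ j : ℕ, ‖coeff j S * (1 / 4) ^ j * countRatio n j -
      coeff j S * (1 / 4) ^ j * (1 + 3 / 2 * (j / n : ℝ))‖ ≤
      45 * B / n ^ 2 * (|coeff j S| * (1 / 3) ^ j) := fun j => by
    rw [← mul_sub, Real.norm_eq_abs, abs_mul, abs_mul,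
      abs_of_nonneg (by positivity : (0 : ℝ) ≤ (1 / 4) ^ j)]
    calc |coeff j S| * (1 / 4) ^ j * |countRatio n j - (1 + 3 / 2 * (j / n : ℝ))|
        ≤ |coeff j S| * (1 / 4) ^ j * (45 * (1 + j) ^ 6 / n ^ 2) := by
          gcongr
          exact abs_countRatio_sub_le hn j
      _ = 45 / n ^ 2 * (|coeff j S| * (1 / 4) ^ j * (1 + j) ^ 6) := by ring
      _ ≤ 45 / n ^ 2 * (B * (|coeff j S| * (1 / 3) ^ j)) := by
          exact mul_le_mul_of_nonneg_left (hdom j) (by positivity)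
      _ = _ := by ring
  refine (tsum_of_norm_bounded (hsum.mul_left _).hasSum hb).trans ?_
  rw [tsum_mul_left]
  calc 45 * B / n ^ 2 * ∑' j, |coeff j S| * (1 / 3) ^ j ≤ 45 * B / n ^ 2 * K := by gcongr
    _ = _ := by ring

/-- The proportion of trees with protection number at least `k` among the plane trees with `n`
vertices. -/
noncomputable def tailProb (n k : ℕ) : ℝ := coeff n (tailGenFun k) / treeCount n

theorem tailProb_zero {n : ℕ} (hn : 1 ≤ n) : tailProb n 0 = 1 :=
  div_self (treeCount_pos hn).ne'

theorem tailProb_one {n : ℕ} (hn : 2 ≤ n) : tailProb n 1 = 1 := by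
  rw [tailProb, tailGenFun_one, map_sub, coeff_X, if_neg (by omega), sub_zero]
  exact div_self (treeCount_pos (by omega)).ne'

theorem exists_abs_tailProb_sub_le :
    ∃ C : ℝ, 0 ≤ C ∧ ∀ n : ℕ, 2 ≤ n → ∀ k : ℕ, 1 ≤ k →
      |tailProb n k - (term0 k + term1 k / n)| ≤ C * (1 / 3) ^ k / n ^ 2 := by
  obtain ⟨A, hA⟩ := exists_coeff_mul_tailGenFun_zero_expansion
  obtain ⟨B, hB0, hB⟩ := exists_bound_pow_mul_geometric 4
  -- These are `8 * 9` and `16 * 9`, where `9` turns `3 ^ (-m)` into `3 ^ (-(m + 2))`.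
  refine ⟨72 * |A| + 144 * B, by positivity, fun n hn k hk => ?_⟩
  have hn0 : (0 : ℝ) < n := by exact_mod_cast (show 0 < n by omega)
  rcases Nat.lt_or_ge k 2 with hk2 | hk2
  · obtain rfl : k = 1 := by omega
    rw [tailProb_one hn, show term0 1 = 1 by norm_num [term0], show term1 1 = 0 by norm_num [term1]]
    simp only [zero_div, add_zero, sub_self, abs_zero]
    positivity
  obtain ⟨m, rfl⟩ : ∃ m, k = m + 2 := ⟨k - 2, by omega⟩
  obtain ⟨v, w, hv, hw, h⟩ := hA _ _ (weightedSum_X_pow_mul_mainFactor_le m)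
  have h := h n (by omega)
  obtain ⟨e0, e1⟩ := value_mainFactor hv hw
  rw [e0, e1] at h
  have hT := treeCount_pos (show 1 ≤ n by omega)
  have hr := abs_coeff_le_of_weightedSum_le (by norm_num)
    (weightedSum_X_pow_mul_regularPart_le m) n
  set R := coeff n (X ^ m * regularPart m)
  have e : tailProb n (m + 2) = coeff n (X ^ m * mainFactor m * tailGenFun 0) / treeCount n +
      R / treeCount n := by
    rw [tailProb, tailGenFun_eq, map_add, add_div]
  have h4 := four_pow_le_treeCount (show 1 ≤ n by omega)
  -- The numerator is `O(3 ^ (n - m))` and `treeCount n` is at least `4 ^ n / (4 n ^ 2)`. The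
  -- surplus `n ^ 4 (3/4) ^ n` is bounded by `B`.
  have hR : |R / treeCount n| ≤ 16 * B * (1 / 3) ^ m / n ^ 2 := by
    rw [abs_div, abs_of_pos hT, div_le_div_iff₀ hT (by positivity)]
    have hb : (n : ℝ) ^ 4 * (3 / 4) ^ n ≤ B := by
      refine le_trans ?_ (hB n)
      gcongr
      linarith
    have h3 : |R| ≤ 4 * (1 / 3) ^ m * 3 ^ n := by
      rw [one_div_pow 3 n, mul_one_div, div_le_iff₀ (by positivity)] at hr
      exact hr
    have h5 : (3 : ℝ) ^ n = (3 / 4) ^ n * 4 ^ n := by rw [← mul_pow]; norm_num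
    calc |R| * (n : ℝ) ^ 2 ≤ 4 * (1 / 3) ^ m * ((3 / 4) ^ n * (4 * n ^ 2 * treeCount n)) * n ^ 2 := by
          refine mul_le_mul_of_nonneg_right (h3.trans ?_) (by positivity)
          rw [h5]
          gcongr
      _ = 16 * (1 / 3) ^ m * treeCount n * (n ^ 4 * (3 / 4) ^ n) := by ring
      _ ≤ 16 * (1 / 3) ^ m * treeCount n * B := by gcongr
      _ = _ := by ring
  have h6 : A * (8 * (1 / 3) ^ m) / n ^ 2 ≤ |A| * (8 * (1 / 3) ^ m) / n ^ 2 := by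
    gcongr
    exact le_abs_self A
  rw [e, add_sub_right_comm]
  refine (abs_add_le _ _).trans ((add_le_add (h.trans h6) hR).trans_eq ?_)
  rw [pow_add]
  ring

end PlaneTree

/-! ### Probabilities and moments through tails -/

namespace PlaneTree

open PowerSeries

instance : MeasurableSingletonClass PlaneTree := ⟨fun _ => trivial⟩

theorem measurable_of_planeTree (f : PlaneTree → ℝ) : Measurable f := fun _ _ => trivial

theorem treeCount_eq_card (n : ℕ) : treeCount n = (finsetOfSize n).card := by
  rw [treeCount, tailGenFun, coeff_genFun, countWhere_eq]
  simp

theorem ofSize_eq (n : ℕ) : ofSize n = finsetOfSize n := by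
  ext t
  simp [mem_finsetOfSize, ofSize]

theorem integral_uniformLaw (n : ℕ) (f : PlaneTree → ℝ) :
    ∫ t, f t ∂(uniformLaw n) = (∑ t ∈ finsetOfSize n, f t) / treeCount n := by
  have hf : IntegrableOn f (finsetOfSize n) Measure.count := by
    rw [← (finsetOfSize n : Set PlaneTree).biUnion_of_singleton]
    simp [integrableOn_finset_iUnion]
  rw [uniformLaw, uniformOn, ProbabilityTheory.cond, integral_smul_measure, ofSize_eq,
    setIntegral_finset _ hf, treeCount_eq_card, Measure.count_apply_finset]
  simp [Measure.real, div_eq_inv_mul]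

theorem uniformLaw_real (n : ℕ) (A : Set PlaneTree) [DecidablePred (· ∈ A)] :
    (uniformLaw n).real A = (∑ t ∈ finsetOfSize n, if t ∈ A then (1 : ℝ) else 0) / treeCount n := by
  rw [← integral_indicator_one (show MeasurableSet A from trivial), integral_uniformLaw]
  simp [Set.indicator_apply]

theorem tailProb_eq (n k : ℕ) : tailProb n k =
    (∑ t ∈ finsetOfSize n, if k ≤ t.protectionNumber then (1 : ℝ) else 0) / treeCount n := by
  rw [tailProb, tailGenFun, coeff_genFun, countWhere_eq, Finset.sum_boole]

theorem prob_eq (n k : ℕ) : prob n k = tailProb n k - tailProb n (k + 1) := by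
  classical
  rw [prob, uniformLaw_real, tailProb_eq, tailProb_eq, ← sub_div, ← Finset.sum_sub_distrib]
  congr 1
  refine Finset.sum_congr rfl fun t _ => ?_
  simp only [Set.mem_ofPred_eq]
  split_ifs <;> first | omega | simp

/-- Summation by parts of the moments of the protection number. -/
theorem hasSum_mul_tailProb {a b : ℕ → ℝ} (h : ∀ p, ∑ k ∈ Finset.range p, a k = b p) (n : ℕ) :
    HasSum (fun k => a k * tailProb n (k + 1)) (∫ t, b t.protectionNumber ∂(uniformLaw n)) := by
  have h1 : ∀ p : ℕ, HasSum (fun k => a k * if k + 1 ≤ p then (1 : ℝ) else 0) (b p) := fun p => by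
    rw [← h p]
    convert hasSum_sum_of_ne_finset_zero (f := fun k => a k * if k + 1 ≤ p then (1 : ℝ) else 0)
      (s := Finset.range p) (L := .unconditional ℕ) ?_ using 1
    · refine Finset.sum_congr rfl fun k hk => ?_
      rw [if_pos (Nat.succ_le_of_lt (Finset.mem_range.1 hk)), mul_one]
    · intro k hk
      rw [if_neg (by simpa using hk), mul_zero]
  have h2 := (hasSum_sum fun t (_ : t ∈ finsetOfSize n) => h1 t.protectionNumber).div_const
    (treeCount n)
  rw [integral_uniformLaw]
  have e : (fun k => a k * tailProb n (k + 1)) = fun k => (∑ t ∈ finsetOfSize n,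
      a k * if k + 1 ≤ t.protectionNumber then (1 : ℝ) else 0) / treeCount n := by
    funext k
    rw [tailProb_eq, ← Finset.mul_sum, mul_div_assoc]
  rw [e]
  exact h2

theorem hasSum_tailProb_expectation (n : ℕ) :
    HasSum (fun k => tailProb n (k + 1)) (expectation n) := by
  simpa [expectation] using hasSum_mul_tailProb (a := fun _ => 1) (b := fun p => p) (by simp) n

theorem hasSum_tailProb_sq (n : ℕ) :
    HasSum (fun k : ℕ => (2 * ((k + 1 : ℕ) : ℝ) - 1) * tailProb n (k + 1))
      (∫ t, (t.protectionNumber : ℝ) ^ 2 ∂(uniformLaw n)) := by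
  refine hasSum_mul_tailProb (b := fun p => (p : ℝ) ^ 2) (fun p => ?_) n
  induction p with
  | zero => simp
  | succ p ih =>
    rw [Finset.sum_range_succ, ih]
    push_cast
    ring

theorem var_eq {n : ℕ} (hn : 1 ≤ n) :
    var n = ∫ t, (t.protectionNumber : ℝ) ^ 2 ∂(uniformLaw n) - expectation n ^ 2 := by
  have hT := (treeCount_pos hn).ne'
  rw [var, variance_eq_integral (measurable_of_planeTree _).aemeasurable, ← expectation,
    integral_uniformLaw, integral_uniformLaw]
  have hE : ∑ t ∈ finsetOfSize n, (t.protectionNumber : ℝ) = expectation n * treeCount n := by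
    rw [expectation, integral_uniformLaw, div_mul_cancel₀ _ hT]
  have e : ∑ t ∈ finsetOfSize n, ((t.protectionNumber : ℝ) - expectation n) ^ 2 =
      ∑ t ∈ finsetOfSize n, (t.protectionNumber : ℝ) ^ 2 - expectation n ^ 2 * treeCount n := by
    simp only [sub_sq, Finset.sum_add_distrib, Finset.sum_sub_distrib, ← Finset.sum_mul,
      ← Finset.mul_sum, hE, Finset.sum_const, nsmul_eq_mul, ← treeCount_eq_card]
    ring
  rw [e, sub_div, mul_div_cancel_right₀ _ hT]

end PlaneTree

/-! ### Telescoping of the coefficients and convergence of the series -/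

namespace ProtectionNumber

theorem limitProb_eq (k : ℕ) : limitProb k = term0 k - term0 (k + 1) := by
  rw [limitProb, term0, term0, mul_comm 2 k, pow_mul, pow_succ (4 : ℝ) k]
  have : (0 : ℝ) < 4 ^ k := by positivity
  generalize (4 : ℝ) ^ k = y at *
  have h1 : y * 4 + 2 ≠ 0 := by positivity
  have h2 : 2 * y + 1 ≠ 0 := by positivity
  field_simp
  ring

theorem corrProb_eq (k : ℕ) : corrProb k = term1 k - term1 (k + 1) := by
  rw [corrProb, term1, term1, mul_add 2 k 1]
  simp only [mul_comm _ k, pow_mul, pow_succ]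
  have : (0 : ℝ) < 4 ^ k := by positivity
  push_cast
  generalize (4 : ℝ) ^ k = y at *
  have h1 : y * 4 + 2 ≠ 0 := by positivity
  have h2 : 2 * y + 1 ≠ 0 := by positivity
  have h3 : y + 2 ≠ 0 := by positivity
  have e : y * 4 + 2 = 2 * (2 * y + 1) := by ring
  simp only [one_mul, pow_zero, e]
  field_simp
  ring

theorem abs_term0_le (k : ℕ) : |term0 k| ≤ 252 * (k + 1) * (1 / 4) ^ k := by
  rw [term0, abs_of_nonneg (by positivity), one_div_pow, mul_one_div,
    div_le_div_iff₀ (by positivity) (by positivity)]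
  have hk : (0 : ℝ) ≤ k := by positivity
  have : (1 : ℝ) ≤ 4 ^ k := one_le_pow₀ (by norm_num)
  generalize (4 : ℝ) ^ k = y at *
  nlinarith [mul_nonneg hk (sq_nonneg (y + 2))]

theorem abs_term1_le (k : ℕ) : |term1 k| ≤ 252 * (k + 1) * (1 / 4) ^ k := by
  rw [term1, mul_comm 2 k, pow_mul, one_div_pow, mul_one_div]
  have hk : (0 : ℝ) ≤ k := by positivity
  have hy : (1 : ℝ) ≤ 4 ^ k := one_le_pow₀ (by norm_num)
  generalize (4 : ℝ) ^ k = y at *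
  have hy0 : 0 < y := by linarith
  rw [abs_div, abs_of_pos (by positivity : 0 < 2 * (y + 2) ^ 4), abs_mul,
    abs_of_pos (by positivity : 0 < 9 * y)]
  have h1 : |(3 * (k : ℝ) - 8) * y ^ 2 + 28 * y - (12 * k + 20)| ≤ 56 * (k + 1) * y ^ 2 := by
    have h2 : y ≤ y ^ 2 := by nlinarith
    rw [abs_le]
    constructor <;> nlinarith [mul_nonneg hk (sq_nonneg y), mul_le_mul_of_nonneg_left h2 hk]
  calc _ ≤ 9 * y * (56 * (k + 1) * y ^ 2) / (2 * y ^ 4) := by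
        gcongr
        linarith
    _ = 252 * (k + 1) / y := by
        field_simp
        ring

theorem sq_le_two_pow {k : ℕ} (hk : 20 ≤ k) : 504 * ((k : ℝ) + 1) ^ 2 ≤ 2 ^ k := by
  induction k, hk using Nat.le_induction with
  | base => norm_num
  | succ k hk ih =>
    have : (20 : ℝ) ≤ k := by exact_mod_cast hk
    rw [pow_succ (2 : ℝ) k]
    push_cast
    nlinarith

/-- Terms dominated by `k * 4 ^ (-k)` are eventually dominated by `2 ^ (-k)`, even after
multiplication by `2 * k - 1`. -/
theorem abs_le_half_pow {c x : ℝ} {k : ℕ} (hk : 20 ≤ k) (hc : |c| ≤ 2 * k + 1)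
    (hx : |x| ≤ 252 * (k + 1) * (1 / 4) ^ k) : |c * x| ≤ (1 / 2) ^ k := by
  have h := sq_le_two_pow hk
  have e : (1 / 4 : ℝ) ^ k = (1 / 2) ^ k * (1 / 2) ^ k := by rw [← mul_pow]; norm_num
  have e' : (2 : ℝ) ^ k * (1 / 2) ^ k = 1 := by rw [← mul_pow]; norm_num
  rw [abs_mul]
  calc |c| * |x| ≤ (2 * (k + 1)) * (252 * (k + 1) * (1 / 4) ^ k) :=
        mul_le_mul (by linarith) hx (abs_nonneg _) (by positivity)
    _ = (504 * ((k : ℝ) + 1) ^ 2) * (1 / 2) ^ k * (1 / 2) ^ k := by rw [e]; ring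
    _ ≤ 2 ^ k * (1 / 2) ^ k * (1 / 2) ^ k := by gcongr
    _ = (1 / 2) ^ k := by rw [e', one_mul]

theorem term2_eq (k : ℕ) : term2 k = (2 * (k : ℝ) - 1) * term0 k := by
  rw [term2, term0]; ring

theorem term3_eq (k : ℕ) : term3 k = (2 * (k : ℝ) - 1) * term1 k := by
  rw [term3, term1]; ring

theorem abs_two_mul_sub_one_le (k : ℕ) : |2 * (k : ℝ) - 1| ≤ 2 * k + 1 := by
  have hk : (0 : ℝ) ≤ k := by positivity
  rw [abs_le]
  constructor <;> linarith

theorem abs_one_le (k : ℕ) : |(1 : ℝ)| ≤ 2 * k + 1 := by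
  have hk : (0 : ℝ) ≤ k := by positivity
  rw [abs_one]
  linarith

theorem abs_term0_le_half_pow {k : ℕ} (hk : 20 ≤ k) : |term0 k| ≤ (1 / 2) ^ k := by
  simpa using abs_le_half_pow hk (abs_one_le k) (abs_term0_le k)

theorem abs_term1_le_half_pow {k : ℕ} (hk : 20 ≤ k) : |term1 k| ≤ (1 / 2) ^ k := by
  simpa using abs_le_half_pow hk (abs_one_le k) (abs_term1_le k)

theorem abs_term2_le_half_pow {k : ℕ} (hk : 20 ≤ k) : |term2 k| ≤ (1 / 2) ^ k := by
  rw [term2_eq]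
  exact abs_le_half_pow hk (abs_two_mul_sub_one_le k) (abs_term0_le k)

theorem abs_term3_le_half_pow {k : ℕ} (hk : 20 ≤ k) : |term3 k| ≤ (1 / 2) ^ k := by
  rw [term3_eq]
  exact abs_le_half_pow hk (abs_two_mul_sub_one_le k) (abs_term1_le k)

theorem summable_of_abs_le_half_pow {f : ℕ → ℝ} (h : ∀ {k}, 20 ≤ k → |f k| ≤ (1 / 2) ^ k) :
    Summable f :=
  Summable.of_norm_bounded_eventually_nat summable_geometric_two
    (eventually_atTop.2 ⟨20, fun _ hk => h hk⟩)

theorem summable_term0 : Summable term0 := summable_of_abs_le_half_pow abs_term0_le_half_pow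

theorem summable_term1 : Summable term1 := summable_of_abs_le_half_pow abs_term1_le_half_pow

theorem summable_term2 : Summable term2 := summable_of_abs_le_half_pow abs_term2_le_half_pow

theorem summable_term3 : Summable term3 := summable_of_abs_le_half_pow abs_term3_le_half_pow

/-- A series `∑ num k / den k` over `k ≥ 1`, dominated by `2 ^ (-k)`, is computed to within
`10 ^ (-70)` by rounding its first `240` terms down to multiples of `10 ^ (-75)`. -/
theorem abs_tsum_sub_le {f : ℕ → ℝ} {num : ℕ → ℤ} {den : ℕ → ℕ} {s : ℤ}
    (h : ∀ {k}, 20 ≤ k → |f k| ≤ (1 / 2) ^ k) (hden : ∀ k, 0 < den k)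
    (hf : ∀ k, f k = num k / den k)
    (hs : ∑ k ∈ Finset.range 240, num (k + 1) * (10 ^ 75 : ℕ) / (den (k + 1) : ℤ) = s) :
    |∑' k, f (k + 1) - s / 10 ^ 75| ≤ 1 / 10 ^ 70 := by
  have hsum : Summable fun k => f (k + 1) :=
    (summable_nat_add_iff 1).2 (summable_of_abs_le_half_pow h)
  have h1 : |∑ k ∈ Finset.range 240, f (k + 1) - s / 10 ^ 75| ≤ 240 / 10 ^ 75 := by
    rw [← hs, Int.cast_sum, Finset.sum_div, ← Finset.sum_sub_distrib]
    refine (Finset.abs_sum_le_sum_abs _ _).trans ?_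
    refine (Finset.sum_le_card_nsmul _ _ (1 / 10 ^ 75) fun k _ => ?_).trans_eq (by norm_num)
    have hd : (0 : ℤ) < den (k + 1) := by exact_mod_cast hden (k + 1)
    have hd' : (0 : ℝ) < den (k + 1) := by exact_mod_cast hden (k + 1)
    set N : ℤ := num (k + 1) * (10 ^ 75 : ℕ)
    -- Floor division loses at most one unit, so each term is off by at most `10 ^ (-75)`.
    have a1 : ((den (k + 1) * (N / den (k + 1)) : ℤ) : ℝ) ≤ N :=
      Int.cast_le.2 (Int.mul_ediv_self_le hd.ne')
    have a2 : ((N : ℤ) : ℝ) ≤ ((den (k + 1) * (N / den (k + 1)) + den (k + 1) : ℤ) : ℝ) :=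
      Int.cast_le.2 (Int.lt_mul_ediv_self_add hd).le
    push_cast [N] at a1 a2
    have e : f (k + 1) = (num (k + 1) * 10 ^ 75 / den (k + 1)) / 10 ^ 75 := by
      rw [hf]
      field_simp
    rw [e, ← sub_div, abs_div, abs_of_pos (by positivity : (0 : ℝ) < 10 ^ 75)]
    gcongr
    rw [abs_of_nonneg]
    · rw [sub_le_iff_le_add, div_le_iff₀ hd']
      push_cast [N]
      linarith
    · rw [sub_nonneg, le_div_iff₀ hd']
      push_cast [N]
      linarith
  have h2 : |∑' k, f (k + 240 + 1)| ≤ (1 / 2) ^ 240 := by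
    have g := (hasSum_geometric_two).mul_left ((1 / 2 : ℝ) ^ 241)
    rw [← Real.norm_eq_abs]
    refine (tsum_of_norm_bounded g fun k => ?_).trans_eq (by norm_num)
    rw [← pow_add, Real.norm_eq_abs, show 241 + k = k + 240 + 1 by omega]
    exact h (by omega)
  have h3 := hsum.sum_add_tsum_nat_add 240
  rw [← h3, add_sub_right_comm]
  refine (abs_add_le _ _).trans ((add_le_add h1 h2).trans ?_)
  norm_num

end ProtectionNumber

/-! ### Numerical values of the constants -/

namespace ProtectionNumber

theorem abs_tsum_term0_sub_le :
    |c0 - 1622971384715353049514658203184345989635513668984063539407824762058373583892 / 10 ^ 75| ≤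
      1 / 10 ^ 70 := by
  refine (abs_tsum_sub_le (num := fun k => (9 * 4 ^ k : ℕ)) (den := fun k => (4 ^ k + 2) ^ 2)
    (s := 1622971384715353049514658203184345989635513668984063539407824762058373583892)
    abs_term0_le_half_pow (fun k => by positivity) (fun k => ?_) (by decide +kernel)).trans_eq' ?_
  · rw [term0]
    push_cast
    ring
  · rw [c0]
    norm_num

theorem abs_tsum_term1_sub_le :
    |c1 - 131187368949423182524448581036673383357742941353142827498279652053972442768 / 10 ^ 75| ≤
      1 / 10 ^ 70 := by
  refine (abs_tsum_sub_le
    (num := fun k => (9 * 4 ^ k : ℕ) * ((3 * k - 8) * (4 ^ (2 * k) : ℕ) + (28 * 4 ^ k : ℕ) -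
      (12 * k + 20 : ℕ)))
    (den := fun k => 2 * (4 ^ k + 2) ^ 4)
    (s := 131187368949423182524448581036673383357742941353142827498279652053972442768)
    abs_term1_le_half_pow (fun k => by positivity) (fun k => ?_) (by decide +kernel)).trans_eq' ?_
  · rw [term1]
    push_cast
    ring
  · rw [c1]
    norm_num

theorem abs_tsum_term2_sub_le :
    |∑' k, term2 (k + 1) -
      3349731187388203181466069888750759752824299629276506891428042169690194202970 / 10 ^ 75| ≤
      1 / 10 ^ 70 := by
  refine (abs_tsum_sub_le
    (num := fun k => (2 * k - 1) * (9 * 4 ^ k : ℕ)) (den := fun k => (4 ^ k + 2) ^ 2)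
    (s := 3349731187388203181466069888750759752824299629276506891428042169690194202970)
    abs_term2_le_half_pow (fun k => by positivity) (fun k => ?_) (by decide +kernel)).trans_eq' ?_
  · rw [term2]
    push_cast
    ring
  · norm_num

theorem abs_tsum_term3_sub_le :
    |∑' k, term3 (k + 1) -
      1177890931091609770090102962415168603431105664285904857796882621821078993353 / 10 ^ 75| ≤
      1 / 10 ^ 70 := by
  refine (abs_tsum_sub_le
    (num := fun k => (2 * k - 1) * ((9 * 4 ^ k : ℕ) * ((3 * k - 8) * (4 ^ (2 * k) : ℕ) +
      (28 * 4 ^ k : ℕ) - (12 * k + 20 : ℕ))))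
    (den := fun k => 2 * (4 ^ k + 2) ^ 4)
    (s := 1177890931091609770090102962415168603431105664285904857796882621821078993353)
    abs_term3_le_half_pow (fun k => by positivity) (fun k => ?_) (by decide +kernel)).trans_eq' ?_
  · rw [term3]
    push_cast
    ring
  · norm_num

theorem abs_c0_sub_lt :
    |c0 - 1.622971384715353049514658203184345989635513668984063539407825| < 1 / 10 ^ 60 := by
  have h := abs_le.1 abs_tsum_term0_sub_le
  rw [abs_lt]
  constructor <;> linarith

theorem abs_c1_sub_lt :
    |c1 - 0.1311873689494231825244485810366733833577429413531428274982796| < 1 / 10 ^ 61 := by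
  have h := abs_le.1 abs_tsum_term1_sub_le
  rw [abs_lt]
  constructor <;> linarith

/-- Replacing both factors of a product by approximations. -/
theorem abs_mul_sub_mul_le {x y a b ε : ℝ} (hx : |x - a| ≤ ε) (hy : |y - b| ≤ ε) (ha : |a| ≤ 2)
    (hb : |b| ≤ 2) (hε : ε ≤ 1) : |x * y - a * b| ≤ 5 * ε := by
  have hε0 : 0 ≤ ε := (abs_nonneg _).trans hx
  have e : x * y - a * b = (x - a) * (y - b) + a * (y - b) + (x - a) * b := by ring
  rw [e]
  refine (abs_add_three _ _ _).trans ?_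
  rw [abs_mul, abs_mul, abs_mul]
  have h1 : |x - a| * |y - b| ≤ 1 * ε := by gcongr; linarith
  have h2 : |a| * |y - b| ≤ 2 * ε := by gcongr
  have h3 : |x - a| * |b| ≤ ε * 2 := by gcongr
  linarith

theorem abs_c2_sub_lt :
    |c2 - 0.71569507178333266731548919868273628601066118785422617431075| < 1 / 10 ^ 59 := by
  have h := abs_le.1 abs_tsum_term2_sub_le
  have h0 := abs_tsum_term0_sub_le
  have h' := abs_le.1 (abs_mul_sub_mul_le h0 h0 (by rw [abs_of_pos] <;> norm_num)
    (by rw [abs_of_pos] <;> norm_num) (by norm_num))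
  rw [c2, sq, abs_lt]
  constructor <;> linarith

theorem abs_c3_sub_lt :
    |c3 - 0.752064239409591264131776195623037076243863867774117959593385| < 1 / 10 ^ 60 := by
  have h := abs_le.1 abs_tsum_term3_sub_le
  have h' := abs_le.1 (abs_mul_sub_mul_le abs_tsum_term0_sub_le abs_tsum_term1_sub_le
    (by rw [abs_of_pos] <;> norm_num) (by rw [abs_of_pos] <;> norm_num) (by norm_num))
  rw [c3, mul_assoc, abs_lt]
  constructor <;> linarith

end ProtectionNumber

/-! ### Limit law and moment asymptotics -/

namespace ProtectionNumber

open PlaneTree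

theorem limitProb_nonneg (k : ℕ) : 0 ≤ limitProb k := by
  have h : (1 : ℝ) ≤ 4 ^ (2 * k) := one_le_pow₀ (by norm_num)
  have h' : (0 : ℝ) ≤ 4 ^ (2 * k) - 1 := by linarith
  rw [limitProb]
  positivity

theorem hasSum_limitProb : HasSum limitProb 1 := by
  rw [hasSum_iff_tendsto_nat_of_nonneg limitProb_nonneg]
  simp only [limitProb_eq, Finset.sum_range_sub']
  have h := (tendsto_const_nhds (x := term0 0)).sub summable_term0.tendsto_atTop_zero
  rwa [show term0 0 - 0 = 1 by norm_num [term0]] at h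

theorem exists_abs_prob_sub_le :
    ∃ C : ℝ, 0 ≤ C ∧ ∀ n : ℕ, 2 ≤ n → ∀ k : ℕ,
      |prob n k - (limitProb k + corrProb k * (1 / (n : ℝ)))| ≤
        C * ((k : ℝ) ^ 2 / (3 ^ k * (n : ℝ) ^ 2)) := by
  obtain ⟨C, hC, h⟩ := exists_abs_tailProb_sub_le
  refine ⟨2 * C, by positivity, fun n hn k => ?_⟩
  have hn0 : (0 : ℝ) < n := by exact_mod_cast (show 0 < n by omega)
  rw [prob_eq, limitProb_eq, corrProb_eq]
  -- At `k = 0` the bound is zero, so the expansion must be exact. It is: for `n ≥ 2` the root is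
  -- not a leaf, and `term0`, `term1` agree at `0` and `1`.
  rcases Nat.eq_zero_or_pos k with rfl | hk
  · rw [tailProb_zero (by omega), tailProb_one hn]
    norm_num [term0, term1]
  · have h1 := h n hn k hk
    have h2 := h n hn (k + 1) (by omega)
    have hk1 : (1 : ℝ) ≤ k := by exact_mod_cast hk
    have e : tailProb n k - tailProb n (k + 1) -
        (term0 k - term0 (k + 1) + (term1 k - term1 (k + 1)) * (1 / (n : ℝ))) =
        (tailProb n k - (term0 k + term1 k / n)) -
          (tailProb n (k + 1) - (term0 (k + 1) + term1 (k + 1) / n)) := by ring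
    rw [e]
    calc _ ≤ C * (1 / 3) ^ k / n ^ 2 + C * (1 / 3) ^ (k + 1) / n ^ 2 :=
          (abs_sub _ _).trans (add_le_add h1 h2)
      _ ≤ C * (1 / 3) ^ k / n ^ 2 + C * (1 / 3) ^ k / n ^ 2 := by
          gcongr _ + C * ?_ / _
          exact pow_le_pow_of_le_one (by norm_num) (by norm_num) (by omega)
      _ = 2 * C * (1 / (3 ^ k * n ^ 2)) := by
          rw [one_div_pow]
          field_simp
          ring
      _ ≤ _ := by
          gcongr
          nlinarith

theorem rpow_three_halves_le_sq {n : ℕ} (hn : 1 ≤ n) : (n : ℝ) ^ (3 / 2 : ℝ) ≤ (n : ℝ) ^ 2 := by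
  rw [← Real.rpow_natCast]
  exact Real.rpow_le_rpow_of_exponent_le (by exact_mod_cast hn) (by norm_num)

theorem isBigO_of_abs_le {f : ℕ → ℝ} {D : ℝ} (h : ∀ n : ℕ, 2 ≤ n → |f n| ≤ D / (n : ℝ) ^ 2) :
    f =O[atTop] fun n : ℕ => 1 / (n : ℝ) ^ (3 / 2 : ℝ) := by
  refine IsBigO.of_bound |D| (eventually_atTop.2 ⟨2, fun n hn => ?_⟩)
  have hn0 : (0 : ℝ) < n := by exact_mod_cast (show 0 < n by omega)
  have hr : (0 : ℝ) < (n : ℝ) ^ (3 / 2 : ℝ) := Real.rpow_pos_of_pos hn0 _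
  rw [Real.norm_eq_abs, Real.norm_of_nonneg (by positivity), mul_one_div]
  calc |f n| ≤ D / (n : ℝ) ^ 2 := h n hn
    _ ≤ |D| / (n : ℝ) ^ 2 := by gcongr; exact le_abs_self D
    _ ≤ |D| / (n : ℝ) ^ (3 / 2 : ℝ) := by
        gcongr
        exact rpow_three_halves_le_sq (by omega)

/-- The tail expansion may be summed termwise because its error decays geometrically in `k`,
uniformly in `n`. -/
theorem exists_abs_moment_sub_le {a : ℕ → ℝ} {m : ℕ → ℝ} {s0 s1 : ℝ}
    (ha : Summable fun k => |a k| * (1 / 3) ^ (k + 1))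
    (h0 : HasSum (fun k => a k * term0 (k + 1)) s0) (h1 : HasSum (fun k => a k * term1 (k + 1)) s1)
    (hm : ∀ n, HasSum (fun k => a k * tailProb n (k + 1)) (m n)) :
    ∃ D : ℝ, ∀ n : ℕ, 2 ≤ n → |m n - (s0 + s1 * (1 / (n : ℝ)))| ≤ D / (n : ℝ) ^ 2 := by
  obtain ⟨C, hC, h⟩ := exists_abs_tailProb_sub_le
  refine ⟨C * ∑' k, |a k| * (1 / 3) ^ (k + 1), fun n hn => ?_⟩
  have hs := (hm n).sub (h0.add (h1.mul_right (1 / (n : ℝ))))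
  rw [← hs.tsum_eq, ← Real.norm_eq_abs]
  refine (tsum_of_norm_bounded (ha.mul_left (C / (n : ℝ) ^ 2)).hasSum fun k => ?_).trans_eq ?_
  · have e : a k * tailProb n (k + 1) -
        (a k * term0 (k + 1) + a k * term1 (k + 1) * (1 / (n : ℝ))) =
        a k * (tailProb n (k + 1) - (term0 (k + 1) + term1 (k + 1) / n)) := by ring
    rw [e, Real.norm_eq_abs, abs_mul]
    calc _ ≤ |a k| * (C * (1 / 3) ^ (k + 1) / n ^ 2) := by
          gcongr
          exact h n hn (k + 1) (by omega)
      _ = _ := by ring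
  · rw [tsum_mul_left]
    ring

theorem exists_abs_expectation_sub_le :
    ∃ D : ℝ, ∀ n : ℕ, 2 ≤ n →
      |expectation n - (c0 + c1 * (1 / (n : ℝ)))| ≤ D / (n : ℝ) ^ 2 := by
  refine exists_abs_moment_sub_le (a := fun _ => 1) ?_ ?_ ?_ fun n => ?_
  · simpa using (summable_nat_add_iff 1).2
      (summable_geometric_of_lt_one (r := (1 / 3 : ℝ)) (by norm_num) (by norm_num))
  · simpa [c0] using ((summable_nat_add_iff 1).2 summable_term0).hasSum
  · simpa [c1] using ((summable_nat_add_iff 1).2 summable_term1).hasSum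
  · simpa using hasSum_tailProb_expectation n

theorem exists_abs_second_moment_sub_le :
    ∃ D : ℝ, ∀ n : ℕ, 2 ≤ n →
      |∫ t, (t.protectionNumber : ℝ) ^ 2 ∂(uniformLaw n) -
        (∑' k, term2 (k + 1) + (∑' k, term3 (k + 1)) * (1 / (n : ℝ)))| ≤ D / (n : ℝ) ^ 2 := by
  refine exists_abs_moment_sub_le (a := fun k => 2 * ((k + 1 : ℕ) : ℝ) - 1) ?_ ?_ ?_
    hasSum_tailProb_sq
  · have h := summable_pow_mul_geometric_of_norm_lt_one 1
      (show ‖(1 / 3 : ℝ)‖ < 1 by rw [Real.norm_of_nonneg] <;> norm_num)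
    have h' := (summable_nat_add_iff 1).2 (h.mul_left 3)
    refine Summable.of_nonneg_of_le (fun _ => by positivity) (fun k => ?_) h'
    rw [← mul_assoc]
    gcongr
    refine (abs_two_mul_sub_one_le (k + 1)).trans ?_
    push_cast
    linarith [(Nat.cast_nonneg k : (0 : ℝ) ≤ k)]
  · simpa only [term2_eq] using ((summable_nat_add_iff 1).2 summable_term2).hasSum
  · simpa only [term3_eq] using ((summable_nat_add_iff 1).2 summable_term3).hasSum

theorem exists_abs_var_sub_le :
    ∃ D : ℝ, ∀ n : ℕ, 2 ≤ n →
      |var n - (c2 + c3 * (1 / (n : ℝ)))| ≤ D / (n : ℝ) ^ 2 := by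
  obtain ⟨D, hD⟩ := exists_abs_expectation_sub_le
  obtain ⟨D', hD'⟩ := exists_abs_second_moment_sub_le
  refine ⟨D' + c1 ^ 2 + 2 * (|c0| + |c1|) * D + D ^ 2, fun n hn => ?_⟩
  have h1 := hD n hn
  have h2 := hD' n hn
  have hn1 : (1 : ℝ) ≤ n := by exact_mod_cast (show 1 ≤ n by omega)
  rw [var_eq (by omega), c2, c3]
  set u := 1 / (n : ℝ) with hu
  have hu0 : 0 ≤ u := by positivity
  have hu1 : u ≤ 1 := by rw [hu, div_le_one₀] <;> linarith
  have hsq : ∀ x : ℝ, x / (n : ℝ) ^ 2 = x * u ^ 2 := fun x => by rw [hu]; ring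
  rw [hsq] at h1 h2 ⊢
  set E := expectation n
  set M := ∫ t, (t.protectionNumber : ℝ) ^ 2 ∂(uniformLaw n)
  set e := E - (c0 + c1 * u) with he
  have hu2 : u ^ 2 ≤ 1 := pow_le_one₀ hu0 hu1
  have hD0 : 0 ≤ D := by
    have hpos : 0 < u ^ 2 := by positivity
    exact nonneg_of_mul_nonneg_left ((abs_nonneg _).trans h1) hpos
  -- Squaring `c0 + c1 * u + e`, with `e = O(u ^ 2)`, leaves only terms of order `u ^ 2` beyond the
  -- linear part.
  have key : M - E ^ 2 - (∑' k, term2 (k + 1) - c0 ^ 2 +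
      (∑' k, term3 (k + 1) - 2 * c0 * c1) * u) =
      (M - (∑' k, term2 (k + 1) + (∑' k, term3 (k + 1)) * u)) + (-(c1 ^ 2 * u ^ 2)) +
        (-(2 * (c0 + c1 * u) * e)) + (-(e ^ 2)) := by
    rw [he]; ring
  rw [key]
  have a1 : |2 * (c0 + c1 * u) * e| ≤ 2 * (|c0| + |c1|) * (D * u ^ 2) := by
    rw [abs_mul, abs_mul, abs_two]
    gcongr
    refine (abs_add_le _ _).trans ?_
    rw [abs_mul, abs_of_nonneg hu0]
    gcongr
    exact mul_le_of_le_one_right (abs_nonneg _) hu1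
  have a2 : |e ^ 2| ≤ D ^ 2 * u ^ 2 := by
    rw [abs_pow]
    calc |e| ^ 2 ≤ (D * u ^ 2) ^ 2 := by gcongr
      _ = D ^ 2 * u ^ 2 * u ^ 2 := by ring
      _ ≤ D ^ 2 * u ^ 2 := mul_le_of_le_one_right (by positivity) hu2
  have a3 : |c1 ^ 2 * u ^ 2| = c1 ^ 2 * u ^ 2 := abs_of_nonneg (by positivity)
  refine (abs_add_le _ _).trans ((add_le_add_left (abs_add_three _ _ _) _).trans ?_)
  rw [abs_neg, abs_neg, abs_neg, a3]
  linarith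

theorem tendsto_prob (k : ℕ) : Tendsto (fun n => prob n k) atTop (𝓝 (limitProb k)) := by
  obtain ⟨C, -, h⟩ := exists_abs_prob_sub_le
  have hinv : Tendsto (fun n : ℕ => 1 / (n : ℝ)) atTop (𝓝 0) := tendsto_one_div_atTop_nhds_zero_nat
  have h1 : Tendsto (fun n : ℕ => limitProb k + corrProb k * (1 / (n : ℝ))) atTop
      (𝓝 (limitProb k)) := by
    simpa using (hinv.const_mul (corrProb k)).const_add (limitProb k)
  have h2 : Tendsto (fun n : ℕ => prob n k - (limitProb k + corrProb k * (1 / (n : ℝ)))) atTop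
      (𝓝 0) := by
    refine squeeze_zero_norm' (a := fun n : ℕ => C * ((k : ℝ) ^ 2 / 3 ^ k) * (1 / (n : ℝ)) ^ 2)
      (eventually_atTop.2 ⟨2, fun n hn => ?_⟩) ?_
    · refine (h n hn k).trans_eq ?_
      rw [one_div_pow]
      field_simp
    · simpa using (hinv.pow 2).const_mul (C * ((k : ℝ) ^ 2 / 3 ^ k))
  simpa using h2.add h1

end ProtectionNumber

theorem theorem1 :
    -- the limit distribution is a probability distribution, and `X_n` converges to it
    (∀ k, 0 ≤ limitProb k) ∧ HasSum limitProb 1 ∧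
    (∀ k, Tendsto (fun n => prob n k) atTop (𝓝 (limitProb k))) ∧
    -- the expansion of `P(X_n = k)`, uniformly in `k`
    (∃ C : ℝ, ∀ᶠ n : ℕ in atTop, ∀ k : ℕ,
      |prob n k - (limitProb k + corrProb k * (1 / (n : ℝ)))|
        ≤ C * ((k : ℝ) ^ 2 / (3 ^ k * (n : ℝ) ^ (3 / 2 : ℝ)))) ∧
    -- the series defining the constants converge
    (Summable fun k => term0 (k + 1)) ∧ (Summable fun k => term1 (k + 1)) ∧
    (Summable fun k => term2 (k + 1)) ∧ (Summable fun k => term3 (k + 1)) ∧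
    -- their numerical values, to within one unit of the last digit
    |c0 - 1.622971384715353049514658203184345989635513668984063539407825| < 1 / 10 ^ 60 ∧
    |c1 - 0.1311873689494231825244485810366733833577429413531428274982796| < 1 / 10 ^ 61 ∧
    |c2 - 0.71569507178333266731548919868273628601066118785422617431075| < 1 / 10 ^ 59 ∧
    |c3 - 0.752064239409591264131776195623037076243863867774117959593385| < 1 / 10 ^ 60 ∧
    -- expectation and variance
    ((fun n : ℕ => expectation n - (c0 + c1 * (1 / (n : ℝ))))
      =O[atTop] fun n : ℕ => 1 / (n : ℝ) ^ (3 / 2 : ℝ)) ∧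
    ((fun n : ℕ => var n - (c2 + c3 * (1 / (n : ℝ))))
      =O[atTop] fun n : ℕ => 1 / (n : ℝ) ^ (3 / 2 : ℝ)) := by
  obtain ⟨C, hC, hprob⟩ := exists_abs_prob_sub_le
  obtain ⟨D, hD⟩ := exists_abs_expectation_sub_le
  obtain ⟨D', hD'⟩ := exists_abs_var_sub_le
  refine ⟨limitProb_nonneg, hasSum_limitProb, tendsto_prob,
    ⟨C, eventually_atTop.2 ⟨2, fun n hn k => (hprob n hn k).trans ?_⟩⟩,
    (summable_nat_add_iff 1).2 summable_term0, (summable_nat_add_iff 1).2 summable_term1,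
    (summable_nat_add_iff 1).2 summable_term2, (summable_nat_add_iff 1).2 summable_term3,
    abs_c0_sub_lt, abs_c1_sub_lt, abs_c2_sub_lt, abs_c3_sub_lt,
    isBigO_of_abs_le hD, isBigO_of_abs_le hD'⟩
  have hn0 : (0 : ℝ) < n := by exact_mod_cast (show 0 < n by omega)
  have hr : (0 : ℝ) < (n : ℝ) ^ (3 / 2 : ℝ) := Real.rpow_pos_of_pos hn0 _
  gcongr
  exact rpow_three_halves_le_sq (by omega)
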